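/- Let $T,N\ge 1$, $D\ge 0$, $\kappa\in\{0,1\}$, $\delta_1,\dots,\delta_T>0$, $\mathsf X=\mathbb R^D$, and write $[N]_0=\{0,\dots,N\}$. $\mathrm N(x;m,S)$ is the density of the Gaussian law $\mathrm N(m,S)$ on $\mathsf X$. Quantities with time index $\le 0$ or $>T$ are ignored (factors are replaced by $1$, arguments are dropped). For functions $Q_t(x_{t-1:t})>0$, $t=1,\dots,T$, such that $\gamma_T(x_{1:T})=\prod_{t=1}^T Q_t(x_{t-1:t})$ is Lebesgue integrable on $\mathsf X^T$, let $\pi_T=\gamma_T/\int\gamma_T$. **The algorithm.** Let $F:\mathsf X^T\to\mathbb R$, let $M'_t(x_t\mid x_{t-1};u_t)$ be Gaussian mutation densities, $G'_t(x_{t-2:t};u_{t-1:t})>0$ potentials and $Q'_t(x_{t-2:t};u_{t-1:t})=M'_t(x_t\mid x_{t-1};u_t)\,G'_t(x_{t-2:t};u_{t-1:t})$. Given $x_{1:T}$, draw independently, for $t=1,\dots,T$, $u_t\sim \mathrm N(x_t+\kappa\tfrac{\delta_t}{2}\nabla_{x_t}F(x_{1:T}),\tfrac{\delta_t}{2}\mathbf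 I)$. Then: 1. For $t=1,\dots,T$: sample $k_t$ uniformly on $[N]_0$ and set $x_t^{k_t}=x_t$; if $t>1$, set $a_{t-1}^{k_t}=k_{t-1}$ and, for $n\ne k_t$, sample $a_{t-1}^n=i$ with probability $W_{t-1}^i$; for $n\neq k_t$ sample $x_t^n\sim M'_t(\cdot\mid x_{t-1}^{a_{t-1}^n};u_t)$; let $x_{1:t}^{(n)}=(x_{1:t-1}^{(a_{t-1}^n)},x_t^n)$, $w_t^n=G'_t(x_{t-2:t}^{(n)};u_{t-1:t})$ and $W_t^n=w_t^n/\sum_m w_t^m$. 2. Sample $i\ne k_T$ with probability $W_T^i/(1-W_T^{k_T})$; set $l_T=i$ with probability $1\wedge\frac{1-W_T^{k_T}}{1-W_T^i}$, and $l_T=k_T$ otherwise. 3. For $t=T-1,\dots,1$: sample $l_t=i\in[N]_0$ with probability proportional to $W_t^i\,Q'_{t+1}((x_{t-1:t}^{(i)},x_{t+1}^{l_{t+1}});u_{t:t+1})\,Q'_{t+2}((x_t^i,x_{t+1}^{l_{t+1}},x_{t+2}^{l_{t+2}});u_{t+1:t+2})$, where $Q'_{T+1}\equiv1$. 4. Return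 $x'_{1:T}=(x_1^{l_1},\dots,x_T^{l_T})$. **(a) Particle-aMALA+.** Let each $Q_t>0$ be differentiable, with $\gamma_T$ integrable. Take $F=\log\pi_T$, $M'_t(x_t\mid x_{t-1};u_t)=\mathrm N(x_t;u_t,\tfrac{\delta_t}2\mathbf I)$ and $$G'_t(x_{t-2:t};u_{t-1:t})=Q_t(x_{t-1:t})\,\frac{\mathrm N(u_t;x_t+\kappa\frac{\delta_t}2\nabla_{x_t}\log Q_t(x_{t-1:t}),\frac{\delta_t}2\mathbf I)}{\mathrm N(u_t;x_t,\frac{\delta_t}2\mathbf I)}\,R_t^{Q},$$ where, for a sequence $f=(f_t)_t$ of functions $f_t(x_{t-1:t})$, $R^f_1=1$ and for $t\ge2$ $$R^f_t=\frac{\mathrm N(u_{t-1};x_{t-1}+\kappa\frac{\delta_{t-1}}2\nabla_{x_{t-1}}[\log f_{t-1}(x_{t-2:t-1})+\log f_t(x_{t-1:t})],\frac{\delta_{t-1}}2\mathbf I)}{\mathrm N(u_{t-1};x_{t-1}+\kappa\frac{\delta_{t-1}}2\nabla_{x_{t-1}}\log f_{t-1}(x_{t-2:t-1}),\frac{\delta_{t-1}}2\mathbf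 I)}.$$ Then the law of $x'_{1:T}$ given $x_{1:T}$ is a Markov kernel on $\mathsf X^T$ which leaves $\pi_T$ invariant. **(b) Particle-aGRAD+.** Let $Q_t(x_{t-1:t})=\mathrm N(x_t;\mathbf m_t(x_{t-1}),\mathbf C_t(x_{t-1}))\,G_t(x_{t-1:t})$ with $\mathbf m_t$, $\mathbf C_t$ measurable, $\mathbf C_t(\cdot)$ symmetric positive definite, $G_t>0$ differentiable, and $\gamma_T$ integrable. Let $\mathbf A_t(x)=(\mathbf C_t(x)+\frac{\delta_t}2\mathbf I)^{-1}\mathbf C_t(x)$. Take $F=\log G_{1:T}$ with $G_{1:T}(x_{1:T})=\prod_{t=1}^TG_t(x_{t-1:t})$, $$M'_t(x_t\mid x_{t-1};u_t)=\mathrm N\bigl(x_t;\mathbf m_t(x_{t-1})+\mathbf A_t(x_{t-1})[u_t-\mathbf m_t(x_{t-1})],(\mathbf I-\mathbf A_t(x_{t-1}))\mathbf C_t(x_{t-1})\bigr),$$ $$G'_t(x_{t-2:t};u_{t-1:t})=Q_t(x_{t-1:t})\,\frac{\mathrm N(u_t;x_t+\kappa\frac{\delta_t}2\nabla_{x_t}\log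 G_t(x_{t-1:t}),\frac{\delta_t}2\mathbf I)}{M'_t(x_t\mid x_{t-1};u_t)}\,R_t^{G}.$$ Then the law of $x'_{1:T}$ given $x_{1:T}$ is a Markov kernel on $\mathsf X^T$ which leaves $\pi_T$ invariant. In both cases the modified model is second-order Markov: for all $x_{1:T},u_{1:T}$, $$\pi_T(x_{1:T})\prod_{t=1}^T\mathrm N\bigl(u_t;x_t+\kappa\tfrac{\delta_t}2\nabla_{x_t}F(x_{1:T}),\tfrac{\delta_t}2\mathbf I\bigr)=\frac{1}{\int\gamma_T}\prod_{t=1}^TQ'_t(x_{t-2:t};u_{t-1:t}).$$ -/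

import Mathlib

open MeasureTheory ProbabilityTheory

noncomputable section

namespace ParticleCSMC

/-- The state space `ℝ^D`. -/
abbrev State (D : ℕ) := EuclideanSpace ℝ (Fin D)

/-- Paths `x_{1:T}`. The entry with index `s : Fin T` is the state at time `s + 1`. -/
abbrev StatePath (T D : ℕ) := Fin T → State D

/-- `coord x t` is the state `x_t` at time `t`, for `t = 1, …, T`. Times outside this range do not
exist; the dummy value `0` is used for them. In particular a factor `Q_1(x_{0:1})` is always
evaluated at the fixed dummy `x_0 = 0`, so that it is a function of `x_1` only. -/
def coord {T D : ℕ} (x : StatePath T D) (t : ℕ) : State D :=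
  if h : 1 ≤ t ∧ t ≤ T then x ⟨t - 1, by omega⟩ else 0

/-- The path `x` with its state at time `t` replaced by `y`. -/
def setCoord {T D : ℕ} (x : StatePath T D) (t : ℕ) (y : State D) : StatePath T D :=
  fun s => if (s : ℕ) + 1 = t then y else x s

/-- The density `N(x; m, S)` of the Gaussian law with mean `m` and non-singular covariance `S`. -/
def gaussianDensity {D : ℕ} (m : State D) (S : Matrix (Fin D) (Fin D) ℝ) (x : State D) : ℝ :=
  (Real.sqrt (((2 * Real.pi) • S).det))⁻¹ *
    Real.exp (-(1 / 2) * ((x - m).ofLp ⬝ᵥ (S⁻¹).mulVec (x - m).ofLp))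

/-- `∏_{s=1}^T f_s(x_{s-1:s})`. -/
def pathProd {D : ℕ} (f : ℕ → State D → State D → ℝ) (T : ℕ) (x : StatePath T D) : ℝ :=
  ∏ s ∈ Finset.Icc 1 T, f s (coord x (s - 1)) (coord x s)

/-- The density of `π_T`, which is proportional to `∏_{s=1}^T Q_s(x_{s-1:s})`. -/
def smoothingDensity {D : ℕ} (Q : ℕ → State D → State D → ℝ) (T : ℕ) (x : StatePath T D) : ℝ :=
  pathProd Q T x / ∫ y : StatePath T D, pathProd Q T y

/-- The joint smoothing distribution `π_T`. -/
def smoothing {D : ℕ} (Q : ℕ → State D → State D → ℝ) (T : ℕ) : Measure (StatePath T D) :=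
  volume.withDensity fun x => ENNReal.ofReal (smoothingDensity Q T x)

/-- `∇_{x_t} F(x_{1:T})`. -/
def blockGrad {T D : ℕ} (F : StatePath T D → ℝ) (t : ℕ) (x : StatePath T D) : State D :=
  gradient (fun y => F (setCoord x t y)) (coord x t)

/-- `∇_{x_t} log f_t(x_{t-1:t})` at `x_{t-1} = a`, `x_t = b`. -/
def gradCur {D : ℕ} (f : ℕ → State D → State D → ℝ) (t : ℕ) (a b : State D) : State D :=
  gradient (fun y => Real.log (f t a y)) b

/-- `∇_{x_{t-1}} log f_t(x_{t-1:t})` at `x_{t-1} = a`, `x_t = b`. -/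
def gradPrev {D : ℕ} (f : ℕ → State D → State D → ℝ) (t : ℕ) (a b : State D) : State D :=
  gradient (fun y => Real.log (f t y b)) a

/-- The covariance `(δ / 2) I`. -/
def halfId (D : ℕ) (δ : ℝ) : Matrix (Fin D) (Fin D) ℝ := (δ / 2) • 1

/-- An auxiliary model, of second order: mutation kernels
`M'_t(x_t | x_{t-1}; u_t) = N(x_t; mean_t(x_{t-1}, u_t), cov_t(x_{t-1}))`
and potentials `G'_t(x_{t-2:t}; u_{t-1:t})`, with arguments in the order
`t, x_{t-2}, x_{t-1}, x_t, u_{t-1}, u_t`. -/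
structure AuxModel (D : ℕ) where
  mean : ℕ → State D → State D → State D
  cov : ℕ → State D → Matrix (Fin D) (Fin D) ℝ
  pot : ℕ → State D → State D → State D → State D → State D → ℝ

/-- The law `M'_t(· | x_{t-1}; u_t)`. -/
def AuxModel.mutation {D : ℕ} (A : AuxModel D) (t : ℕ) (x1 u : State D) : Measure (State D) :=
  multivariateGaussian (A.mean t x1 u) (A.cov t x1)

/-- The density `M'_t(x_t | x_{t-1}; u_t)`. -/
def AuxModel.mutationDensity {D : ℕ} (A : AuxModel D) (t : ℕ) (x1 u x0 : State D) : ℝ :=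
  gaussianDensity (A.mean t x1 u) (A.cov t x1) x0

/-- `Q'_t(x_{t-2:t}; u_{t-1:t}) = M'_t(x_t | x_{t-1}; u_t) G'_t(x_{t-2:t}; u_{t-1:t})`. -/
def AuxModel.incr {D : ℕ} (A : AuxModel D) (t : ℕ) (x2 x1 x0 u1 u0 : State D) : ℝ :=
  A.mutationDensity t x1 u0 x0 * A.pot t x2 x1 x0 u1 u0

/-- `∏_{t=1}^T Q'_t(x_{t-2:t}; u_{t-1:t})`. -/
def AuxModel.incrProd {D : ℕ} (A : AuxModel D) {T : ℕ} (x u : StatePath T D) : ℝ :=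
  ∏ t ∈ Finset.Icc 1 T,
    A.incr t (coord x (t - 2)) (coord x (t - 1)) (coord x t) (coord u (t - 1)) (coord u t)

/-- The particle system at time `t`: the position `k_t` of the reference particle and, for each
`n = 0, …, N`, the last three states `x_{t-2:t}^{(n)}` of the `n`th surviving lineage. -/
abbrev Gen (N D : ℕ) := Fin (N + 1) × (Fin (N + 1) → State D × State D × State D)

/-- Sampling `i` with probability `w_i / ∑_j w_j`. -/
def categorical {N : ℕ} (w : Fin (N + 1) → ℝ) : Measure (Fin (N + 1)) :=
  ∑ i, ENNReal.ofReal (w i / ∑ j, w j) • Measure.dirac i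

/-- The unnormalised weights `w_t^n = G'_t(x_{t-2:t}^{(n)}; u_{t-1:t})`. -/
def weight {T N D : ℕ} (A : AuxModel D) (u : StatePath T D) (t : ℕ) (g : Gen N D) (n : Fin (N + 1)) :
    ℝ :=
  A.pot t (g.2 n).1 (g.2 n).2.1 (g.2 n).2.2 (coord u (t - 1)) (coord u t)

/-- The normalised weights `W_t^n`. -/
def normWeight {T N D : ℕ} (A : AuxModel D) (u : StatePath T D) (t : ℕ) (g : Gen N D)
    (n : Fin (N + 1)) : ℝ :=
  weight A u t g n / ∑ m, weight A u t g m

/-- The particle system at time `1`, given the reference path `x`. -/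
def firstGen {T D : ℕ} (N : ℕ) (A : AuxModel D) (u x : StatePath T D) : Measure (Gen N D) :=
  (categorical fun _ : Fin (N + 1) => 1).bind fun k =>
  (Measure.pi fun n : Fin (N + 1) =>
    if n = k then Measure.dirac (coord x 1) else A.mutation 1 0 (coord u 1)).bind fun z =>
  Measure.dirac (k, fun n => (0, 0, z n))

/-- The particle system at time `t + 1` given the one at time `t` and the reference path `x`:
sample `k_{t+1}` uniformly, set `a_t^{k_{t+1}} = k_t` and sample the other ancestors `a_t^n` from
the weights `W_t`; set the particle with index `k_{t+1}` to `x_{t+1}` and sample the others from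
the mutation kernel; extend the lineages. -/
def nextGen {T N D : ℕ} (A : AuxModel D) (u x : StatePath T D) (t : ℕ) (g : Gen N D) :
    Measure (Gen N D) :=
  (categorical fun _ : Fin (N + 1) => 1).bind fun k =>
  (Measure.pi fun n : Fin (N + 1) =>
    if n = k then Measure.dirac g.1 else categorical (normWeight A u t g)).bind fun a =>
  (Measure.pi fun n : Fin (N + 1) =>
    if n = k then Measure.dirac (coord x (t + 1))
    else A.mutation (t + 1) (g.2 (a n)).2.2 (coord u (t + 1))).bind fun z =>
  Measure.dirac (k, fun n => ((g.2 (a n)).2.1, (g.2 (a n)).2.2, z n))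

/-- The forced move: sample `i ≠ k` with probability `W^i / (1 - W^k)`; return `i` with probability
`min 1 ((1 - W^k) / (1 - W^i))` and `k` otherwise. -/
def forcedMove {N : ℕ} (W : Fin (N + 1) → ℝ) (k : Fin (N + 1)) : Measure (Fin (N + 1)) :=
  (∑ i ∈ Finset.univ.erase k, ENNReal.ofReal (W i / (1 - W k)) • Measure.dirac i).bind fun i =>
    ENNReal.ofReal (min 1 ((1 - W k) / (1 - W i))) • Measure.dirac i +
      ENNReal.ofReal (1 - min 1 ((1 - W k) / (1 - W i))) • Measure.dirac k

/-- The two-step backward-sampling kernel for `l_t`, given the particle system `g` at time `t` and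
a path `y` whose states at the times `t + 1` and `t + 2` are those already selected. The factor
`Q'_{t+2}` is absent if `t + 2 > T`. -/
def backward {T N D : ℕ} (A : AuxModel D) (u : StatePath T D) (t : ℕ) (g : Gen N D) (y : StatePath T D) :
    Measure (Fin (N + 1)) :=
  categorical fun i =>
    normWeight A u t g i *
      A.incr (t + 1) (g.2 i).2.1 (g.2 i).2.2 (coord y (t + 1)) (coord u t) (coord u (t + 1)) *
      (if t + 2 ≤ T then
        A.incr (t + 2) (g.2 i).2.2 (coord y (t + 1)) (coord y (t + 2))
          (coord u (t + 1)) (coord u (t + 2))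
      else 1)

/-- The rest of the algorithm from time `t` on, if `r` times are left after `t`, given the particle
system at time `t`. The forward pass runs until `r = 0`, where `l_T` is sampled; each earlier index
`l_t` is sampled after the selection at the times `t + 1, …, T`. The result is a path that holds
the selected states at the times `t, …, T` (and `0` before). -/
def sweep {T N D : ℕ} (A : AuxModel D) (u x : StatePath T D) : ℕ → ℕ → Gen N D → Measure (StatePath T D)
  | 0, t, g =>
    (forcedMove (normWeight A u t g) g.1).bind fun l =>
    Measure.dirac (setCoord 0 t (g.2 l).2.2)
  | r + 1, t, g =>
    (nextGen A u x t g).bind fun g1 =>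
    (sweep A u x r (t + 1) g1).bind fun y =>
    (backward A u t g y).bind fun l =>
    Measure.dirac (setCoord y t (g.2 l).2.2)

/-- The law of the output of the conditional sequential Monte Carlo algorithm with forced move and
backward sampling, for the auxiliary model `A`, given the auxiliary variables `u` and the
reference path `x`. -/
def csmc {T D : ℕ} (N : ℕ) (A : AuxModel D) (u x : StatePath T D) : Measure (StatePath T D) :=
  (firstGen N A u x).bind (sweep A u x (T - 1) 1)

/-- The mean `x_t + κ (δ_t / 2) ∇_{x_t} F(x_{1:T})` of the auxiliary variable `u_t`. -/
def auxMean {T D : ℕ} (F : StatePath T D → ℝ) (κ : ℝ) (δ : ℕ → ℝ) (x : StatePath T D) (t : ℕ) : State D :=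
  coord x t + (κ * (δ t / 2)) • blockGrad F t x

/-- The law of `u_{1:T}` given `x_{1:T}`: independent with `u_t ~ N(auxMean_t, (δ_t / 2) I)`. -/
def auxLaw {T D : ℕ} (F : StatePath T D → ℝ) (κ : ℝ) (δ : ℕ → ℝ) (x : StatePath T D) : Measure (StatePath T D) :=
  Measure.pi fun s : Fin T =>
    multivariateGaussian (auxMean F κ δ x (s + 1)) (halfId D (δ (s + 1)))

/-- The density of `auxLaw`. -/
def auxDensity {T D : ℕ} (F : StatePath T D → ℝ) (κ : ℝ) (δ : ℕ → ℝ) (x u : StatePath T D) : ℝ :=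
  ∏ t ∈ Finset.Icc 1 T, gaussianDensity (auxMean F κ δ x t) (halfId D (δ t)) (coord u t)

/-- The correction that turns the filter gradient at time `t - 1` into the smoothing gradient,
`N(u_{t-1}; x_{t-1} + κ (δ_{t-1} / 2) ∇_{x_{t-1}} [log f_{t-1}(x_{t-2:t-1}) + log f_t(x_{t-1:t})], ·)`
divided by `N(u_{t-1}; x_{t-1} + κ (δ_{t-1} / 2) ∇_{x_{t-1}} log f_{t-1}(x_{t-2:t-1}), ·)`; there
is none at time `1`. -/
def smoothingRatio {D : ℕ} (f : ℕ → State D → State D → ℝ) (κ : ℝ) (δ : ℕ → ℝ) (t : ℕ)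
    (x2 x1 x0 u1 : State D) : ℝ :=
  if 2 ≤ t then
    gaussianDensity
        (x1 + (κ * (δ (t - 1) / 2)) • (gradCur f (t - 1) x2 x1 + gradPrev f t x1 x0))
        (halfId D (δ (t - 1))) u1 /
      gaussianDensity (x1 + (κ * (δ (t - 1) / 2)) • gradCur f (t - 1) x2 x1)
        (halfId D (δ (t - 1))) u1
  else 1

/-- The auxiliary model of Particle-aMALA+. The gradient `∇_{x_t} log π_t(x_{1:t})` is
`∇_{x_t} log Q_t(x_{t-1:t})`. -/
def amalaPlusModel {D : ℕ} (Q : ℕ → State D → State D → ℝ) (κ : ℝ) (δ : ℕ → ℝ) : AuxModel D where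
  mean _ _ u := u
  cov t _ := halfId D (δ t)
  pot t x2 x1 x0 u1 u0 :=
    Q t x1 x0 *
      (gaussianDensity (x0 + (κ * (δ t / 2)) • gradCur Q t x1 x0) (halfId D (δ t)) u0 /
        gaussianDensity x0 (halfId D (δ t)) u0) *
      smoothingRatio Q κ δ t x2 x1 x0 u1

/-- `log π_T`. -/
def logSmoothing {D : ℕ} (Q : ℕ → State D → State D → ℝ) (T : ℕ) (x : StatePath T D) : ℝ :=
  Real.log (smoothingDensity Q T x)

/-- One iteration of Particle-aMALA+: the law of the new path given the current path `x`. -/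
def particleAmalaPlus {T D : ℕ} (N : ℕ) (Q : ℕ → State D → State D → ℝ) (κ : ℝ) (δ : ℕ → ℝ)
    (x : StatePath T D) : Measure (StatePath T D) :=
  (auxLaw (logSmoothing Q T) κ δ x).bind fun u => csmc N (amalaPlusModel Q κ δ) u x

/-- `Q_t(x_{t-1:t}) = M_t(x_t | x_{t-1}) G_t(x_{t-1:t})` with conditionally Gaussian dynamics
`M_t(x_t | x_{t-1}) = N(x_t; m_t(x_{t-1}), C_t(x_{t-1}))`. -/
def gaussianIncr {D : ℕ} (m : ℕ → State D → State D)
    (C : ℕ → State D → Matrix (Fin D) (Fin D) ℝ) (G : ℕ → State D → State D → ℝ)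
    (t : ℕ) (a b : State D) : ℝ :=
  gaussianDensity (m t a) (C t a) b * G t a b

/-- `A_t = (C_t + (δ_t / 2) I)⁻¹ C_t`. -/
def gain {D : ℕ} (C : Matrix (Fin D) (Fin D) ℝ) (δ : ℝ) : Matrix (Fin D) (Fin D) ℝ :=
  (C + halfId D δ)⁻¹ * C

/-- The mean `m_t(x) + A_t(x) [u - m_t(x)]` of the Particle-aGRAD proposal. -/
def agradMean {D : ℕ} (m : ℕ → State D → State D)
    (C : ℕ → State D → Matrix (Fin D) (Fin D) ℝ) (δ : ℕ → ℝ) (t : ℕ) (x u : State D) : State D :=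
  m t x + WithLp.toLp 2 ((gain (C t x) (δ t)).mulVec (u - m t x).ofLp)

/-- The covariance `(I - A_t(x)) C_t(x)` of the Particle-aGRAD proposal. -/
def agradCov {D : ℕ} (C : ℕ → State D → Matrix (Fin D) (Fin D) ℝ) (δ : ℕ → ℝ) (t : ℕ)
    (x : State D) : Matrix (Fin D) (Fin D) ℝ :=
  (1 - gain (C t x) (δ t)) * C t x

/-- The auxiliary model of Particle-aGRAD+. -/
def agradPlusModel {D : ℕ} (m : ℕ → State D → State D)
    (C : ℕ → State D → Matrix (Fin D) (Fin D) ℝ) (G : ℕ → State D → State D → ℝ)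
    (κ : ℝ) (δ : ℕ → ℝ) : AuxModel D where
  mean := agradMean m C δ
  cov := agradCov C δ
  pot t x2 x1 x0 u1 u0 :=
    gaussianIncr m C G t x1 x0 *
      (gaussianDensity (x0 + (κ * (δ t / 2)) • gradCur G t x1 x0) (halfId D (δ t)) u0 /
        gaussianDensity (agradMean m C δ t x1 u0) (agradCov C δ t x1) x0) *
      smoothingRatio G κ δ t x2 x1 x0 u1

/-- `log G_{1:T}`. -/
def logPotential {D : ℕ} (G : ℕ → State D → State D → ℝ) (T : ℕ) (x : StatePath T D) : ℝ :=
  Real.log (pathProd G T x)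

/-- One iteration of Particle-aGRAD+: the law of the new path given the current path `x`. -/
def particleAgradPlus {T D : ℕ} (N : ℕ) (m : ℕ → State D → State D)
    (C : ℕ → State D → Matrix (Fin D) (Fin D) ℝ) (G : ℕ → State D → State D → ℝ)
    (κ : ℝ) (δ : ℕ → ℝ) (x : StatePath T D) : Measure (StatePath T D) :=
  (auxLaw (logPotential G T) κ δ x).bind fun u => csmc N (agradPlusModel m C G κ δ) u x

end ParticleCSMC

end

open ParticleCSMC

/-! The transition is a Gibbs sampler on an extended space. Give the path and the auxiliary
variables the joint density `π_T(x) N(u | x)`. Drawing `u` from its conditional law, and then moving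
`x` by a kernel that preserves the conditional law of `x` given `u`, leaves the marginal `π_T`
invariant (`AuxModel.Regular.exists_invariant_kernel`). Two facts remain.

The joint density is the product of the increments `Q'_t`, up to the normalising constant. The state
`x_t` occurs only in the factors `t` and `t + 1`, so its gradient has two terms, the second of which
involves `x_{t+1}`. The potential at time `t` carries the Gaussian factor of `u_t` with the first
term only; the ratio `R_{t+1}` exchanges it for the factor with both terms. The product telescopes
(`prod_mul_ratio_eq`, `smoothingDensity_mul_auxDensity`), and the mutation densities cancel inside
each `Q'_t`.

For fixed `u`, the conditional sequential Monte Carlo step preserves the measure with density `∏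
Q'_t` (`AuxModel.Regular.lintegral_csmc`). The proof is a backward induction over time on
`SweepInvariant`, for a fixed set of lineages, and rests on three observations. A reference particle
that is drawn like the others and put at a uniform position cannot be told from them, so the
generation is one of independent draws with an independent uniform label, and the potentials turn
that label into a draw from the weights (`AuxModel.Regular.lintegral_nextGen_eq_offspring`,
`AuxModel.Regular.sum_tailIntegral_step`). The forced move satisfies detailed balance with respect
to the final weights (`sum_lintegral_forcedMove`). Backward sampling redraws an index from its exact
conditional law, because in a second-order model only two future increments see the lineage
(`AuxModel.Regular.sum_lintegral_backward`). -/

namespace ParticleCSMC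

open scoped ENNReal

/-! ### Densities of finite product measures. -/

section Product

variable {ι : Type*} [DecidableEq ι] {X : ι → Type*} [∀ i, MeasurableSpace (X i)]
  {μ : ∀ i, Measure (X i)}

theorem lmarginal_finset_prod [∀ i, SigmaFinite (μ i)] {f : ∀ i, X i → ℝ≥0∞}
    (hf : ∀ i, Measurable (f i)) (s : Finset ι) :
    (∫⋯∫⁻_s, (fun x => ∏ i ∈ s, f i (x i)) ∂μ) = fun _ => ∏ i ∈ s, ∫⁻ y, f i y ∂μ i := by
  have hm : ∀ s : Finset ι, Measurable fun x : ∀ i, X i => ∏ i ∈ s, f i (x i) := fun s =>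
    Finset.measurable_prod _ fun i _ => (hf i).comp (measurable_pi_apply i)
  induction s using Finset.induction with
  | empty => simp
  | insert i s hi ih =>
    rw [lmarginal_insert' _ (hm _) hi]
    have h : (fun x : ∀ i, X i => ∫⁻ y, ∏ j ∈ insert i s, f j (Function.update x i y j) ∂μ i) =
        fun x => (∫⁻ y, f i y ∂μ i) * ∏ j ∈ s, f j (x j) := by
      funext x
      rw [← lintegral_mul_const _ (hf i)]
      refine lintegral_congr fun y => ?_
      rw [Finset.prod_insert hi, Function.update_self]
      congr 1
      refine Finset.prod_congr rfl fun j hj => ?_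
      rw [Function.update_of_ne (ne_of_mem_of_not_mem hj hi)]
    rw [h]
    funext x
    rw [Finset.prod_insert hi, ← congrFun ih x]
    exact lintegral_const_mul _ ((hm s).comp measurable_updateFinset)

variable [Fintype ι]

theorem lintegral_pi_prod [∀ i, SigmaFinite (μ i)] {f : ∀ i, X i → ℝ≥0∞}
    (hf : ∀ i, Measurable (f i)) :
    ∫⁻ x, ∏ i, f i (x i) ∂Measure.pi μ = ∏ i, ∫⁻ y, f i y ∂μ i := by
  -- Marginal integrals need a base point. If there is none, some factor is empty and both sides
  -- vanish.
  by_cases h : Nonempty (∀ i, X i)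
  · obtain ⟨x⟩ := h
    rw [lintegral_eq_lmarginal_univ x, lmarginal_finset_prod hf]
  · rw [not_nonempty_iff] at h
    obtain ⟨i, hi⟩ : ∃ i, IsEmpty (X i) := by
      by_contra! hc
      exact h.false fun i => (hc i).some
    rw [lintegral_of_isEmpty, eq_comm]
    exact Finset.prod_eq_zero (Finset.mem_univ i) (lintegral_of_isEmpty _ _)

theorem pi_withDensity [∀ i, SigmaFinite (μ i)] {f : ∀ i, X i → ℝ≥0∞}
    (hf : ∀ i, Measurable (f i)) [∀ i, SigmaFinite ((μ i).withDensity (f i))] :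
    Measure.pi (fun i => (μ i).withDensity (f i)) =
      (Measure.pi μ).withDensity fun x => ∏ i, f i (x i) := by
  refine Measure.pi_eq fun s hs => ?_
  rw [withDensity_apply _ (MeasurableSet.univ_pi hs), ← lintegral_indicator (MeasurableSet.univ_pi hs)]
  -- The indicator of a box is a product of indicators, so the integral over the box factorises.
  have h : (Set.univ.pi s).indicator (fun x : ∀ i, X i => ∏ i, f i (x i)) =
      fun x => ∏ i, (s i).indicator (f i) (x i) := by
    funext x
    by_cases hx : x ∈ Set.univ.pi s
    · rw [Set.indicator_of_mem hx]
      exact Finset.prod_congr rfl fun i _ => (Set.indicator_of_mem (hx i (Set.mem_univ i)) _).symm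
    · rw [Set.indicator_of_notMem hx]
      simp only [Set.mem_pi, Set.mem_univ, forall_const, not_forall] at hx
      obtain ⟨i, hi⟩ := hx
      exact (Finset.prod_eq_zero (Finset.mem_univ i) (Set.indicator_of_notMem hi _)).symm
  rw [h, lintegral_pi_prod fun i => (hf i).indicator (hs i)]
  refine Finset.prod_congr rfl fun i _ => ?_
  rw [lintegral_indicator (hs i), withDensity_apply _ (hs i)]

end Product

/-! ### Product measures with one coordinate held fixed. -/

section Resample

variable {ι : Type*} [Fintype ι] [DecidableEq ι] {X : Type*} [MeasurableSpace X]
  {μ : ι → Measure X} [∀ i, IsProbabilityMeasure (μ i)]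

instance isProbabilityMeasure_ite_dirac (k n : ι) (y : X) :
    IsProbabilityMeasure (if n = k then Measure.dirac y else μ n) := by
  split_ifs <;> infer_instance

/-- Drawing the coordinate `k` from `μ k` and overwriting it by `y` is harmless because `μ k` has
mass one. The underlying product measure then no longer depends on `y`. -/
theorem pi_ite_dirac (k : ι) (y : X) :
    Measure.pi (fun n => if n = k then Measure.dirac y else μ n) =
      (Measure.pi μ).map fun z => Function.update z k y := by
  refine Measure.pi_eq fun s hs => ?_
  rw [Measure.map_apply measurable_update_left (MeasurableSet.univ_pi hs)]
  by_cases hy : y ∈ s k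
  · have : (fun z : ι → X => Function.update z k y) ⁻¹' Set.univ.pi s =
        Set.univ.pi (Function.update s k Set.univ) := by
      ext z
      simp only [Set.mem_preimage, Set.mem_pi, Set.mem_univ, forall_const]
      refine forall_congr' fun n => ?_
      by_cases hn : n = k
      · subst hn; simp [hy]
      · simp [hn]
    rw [this, Measure.pi_pi]
    refine Finset.prod_congr rfl fun n _ => ?_
    by_cases hn : n = k
    · subst hn; simp [hs n, hy]
    · simp [hn]
  · have : (fun z : ι → X => Function.update z k y) ⁻¹' Set.univ.pi s = ∅ := by
      ext z
      simp only [Set.mem_preimage, Set.mem_pi, Set.mem_univ, forall_const, Set.mem_empty_iff_false,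
        iff_false, not_forall]
      exact ⟨k, by simpa using hy⟩
    rw [this, measure_empty, eq_comm]
    exact Finset.prod_eq_zero (Finset.mem_univ k) (by simp [hs k, hy])

/-- The overwritten draw of the coordinate `k` integrates to one; the outer integral supplies that
coordinate afresh. -/
theorem lintegral_lintegral_pi_update (k : ι) {Ψ : (ι → X) → ℝ≥0∞} (hΨ : Measurable Ψ) :
    ∫⁻ y, ∫⁻ z, Ψ (Function.update z k y) ∂Measure.pi μ ∂μ k = ∫⁻ z, Ψ z ∂Measure.pi μ := by
  have x : ι → X := fun i => (nonempty_of_isProbabilityMeasure (μ i)).some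
  rw [lintegral_eq_lmarginal_univ x, lmarginal_erase _ hΨ (Finset.mem_univ k)]
  refine lintegral_congr fun y => ?_
  have hm : Measurable fun z : ι → X => Ψ (Function.update z k y) :=
    hΨ.comp measurable_update_left
  rw [lintegral_eq_lmarginal_univ x, lmarginal_erase _ hm (Finset.mem_univ k)]
  have h : ∀ y' : X, (∫⋯∫⁻_Finset.univ.erase k, (fun z => Ψ (Function.update z k y)) ∂μ)
      (Function.update x k y') =
        (∫⋯∫⁻_Finset.univ.erase k, Ψ ∂μ) (Function.update x k y) := fun y' => by
    rw [← Function.comp_def, ← lmarginal_update_of_notMem hΨ (Finset.notMem_erase k _),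
      Function.update_idem]
  simp [h]

/-- Drawing the coordinate `k` first and then the others, with coordinate `k` held fixed, is the same
as drawing all the coordinates independently. -/
theorem lintegral_lintegral_pi_ite_dirac (k : ι) {Θ : X → (ι → X) → ℝ≥0∞}
    (hΘ : Measurable (Function.uncurry Θ)) :
    ∫⁻ y, ∫⁻ z, Θ y z ∂Measure.pi (fun n => if n = k then Measure.dirac y else μ n) ∂μ k =
      ∫⁻ z, Θ (z k) z ∂Measure.pi μ := by
  have hm : Measurable fun z : ι → X => Θ (z k) z :=
    hΘ.comp (f := fun z : ι → X => (z k, z)) ((measurable_pi_apply k).prodMk measurable_id)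
  rw [← lintegral_lintegral_pi_update k hm]
  refine lintegral_congr fun y => ?_
  have hy : Measurable (Θ y) := hΘ.comp (measurable_const.prodMk measurable_id)
  rw [pi_ite_dirac, lintegral_map hy measurable_update_left]
  simp

end Resample

/-! ### Measurable families of probability measures. -/

section MarkovMap

variable {α β γ : Type*} [MeasurableSpace α] [MeasurableSpace β] [MeasurableSpace γ]

/-- A measurable family of probability measures. -/
def IsMarkovMap (f : α → Measure β) : Prop :=
  Measurable f ∧ ∀ a, IsProbabilityMeasure (f a)

theorem IsMarkovMap.comp {f : β → Measure γ} (hf : IsMarkovMap f) {g : α → β} (hg : Measurable g) :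
    IsMarkovMap fun a => f (g a) :=
  ⟨hf.1.comp hg, fun a => hf.2 (g a)⟩

theorem isMarkovMap_dirac {g : α → β} (hg : Measurable g) :
    IsMarkovMap fun a => Measure.dirac (g a) :=
  ⟨Measure.measurable_dirac.comp hg, fun _ => inferInstance⟩

theorem IsMarkovMap.measurable_lintegral {m : α → Measure β} (hm : IsMarkovMap m)
    {f : α → β → ℝ≥0∞} (hf : Measurable (Function.uncurry f)) :
    Measurable fun a => ∫⁻ b, f a b ∂m a := by
  let κ : Kernel α β := ⟨m, hm.1⟩
  have : IsMarkovKernel κ := ⟨hm.2⟩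
  exact Measurable.lintegral_kernel_prod_right (κ := κ) hf

/-- The second family may depend on the parameter as well as on the first draw, hence the joint
measurability; this is what lets nested draws be composed. -/
theorem IsMarkovMap.bind {m : α → Measure β} (hm : IsMarkovMap m) {f : α → β → Measure γ}
    (hf : IsMarkovMap (Function.uncurry f)) : IsMarkovMap fun a => (m a).bind (f a) := by
  have hfa : ∀ a, Measurable (f a) := fun a => hf.1.comp (measurable_const.prodMk measurable_id)
  refine ⟨Measure.measurable_of_measurable_coe _ fun s hs => ?_, fun a => ⟨?_⟩⟩
  · simp_rw [fun a => Measure.bind_apply hs (hfa a).aemeasurable]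
    exact hm.measurable_lintegral ((Measure.measurable_coe hs).comp hf.1)
  · rw [Measure.bind_apply MeasurableSet.univ (hfa a).aemeasurable]
    have := hm.2 a
    have : ∀ b, f a b Set.univ = 1 := fun b => (hf.2 (a, b)).measure_univ
    simp [this]

/-- Boxes form a generating π-system, and on a box the product measure is a finite product of
measurable functions of the parameter. -/
theorem IsMarkovMap.pi {ι : Type*} [Fintype ι] {μ : α → ι → Measure β}
    (h : ∀ i, IsMarkovMap fun a => μ a i) : IsMarkovMap fun a => Measure.pi (μ a) := by
  have : ∀ a i, IsProbabilityMeasure (μ a i) := fun a i => (h i).2 a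
  refine ⟨?_, fun a => inferInstance⟩
  refine Measurable.measure_of_isPiSystem_of_isProbabilityMeasure generateFrom_pi.symm isPiSystem_pi ?_
  rintro _ ⟨s, hs, rfl⟩
  simp_rw [Measure.pi_pi]
  exact Finset.measurable_prod _ fun i _ =>
    (Measure.measurable_coe (hs i (Set.mem_univ i))).comp (h i).1

theorem isMarkovMap_sum_dirac {ι : Type*} [Fintype ι] {p : α → ι → ℝ≥0∞}
    (hp : ∀ i, Measurable fun a => p a i) (h1 : ∀ a, ∑ i, p a i = 1) {g : α → ι → β}
    (hg : ∀ i, Measurable fun a => g a i) :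
    IsMarkovMap fun a => ∑ i, p a i • Measure.dirac (g a i) := by
  refine ⟨Measure.measurable_of_measurable_coe _ fun s hs => ?_, fun a => ⟨?_⟩⟩
  · simp only [Measure.coe_finsetSum, Finset.sum_apply, Measure.smul_apply, smul_eq_mul]
    exact Finset.measurable_sum _ fun i _ => (hp i).mul
      ((Measure.measurable_coe hs).comp (Measure.measurable_dirac.comp (hg i)))
  · simp [Measure.coe_finsetSum, h1]

end MarkovMap

/-! ### Categorical laws. -/

section Categorical

variable {N : ℕ} {α : Type*} [MeasurableSpace α]

theorem lintegral_categorical (w : Fin (N + 1) → ℝ) (f : Fin (N + 1) → ℝ≥0∞) :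
    ∫⁻ i, f i ∂categorical w = ∑ i, ENNReal.ofReal (w i / ∑ j, w j) * f i := by
  simp [categorical, lintegral_finsetSum_measure]

theorem sum_ofReal_div_sum {w : Fin (N + 1) → ℝ} (hw : ∀ i, 0 < w i) :
    ∑ i, ENNReal.ofReal (w i / ∑ j, w j) = 1 := by
  have hs : 0 < ∑ j, w j := Finset.sum_pos (fun i _ => hw i) Finset.univ_nonempty
  rw [← ENNReal.ofReal_sum_of_nonneg fun i _ => (div_pos (hw i) hs).le, ← Finset.sum_div,
    div_self hs.ne', ENNReal.ofReal_one]

theorem isMarkovMap_categorical {w : α → Fin (N + 1) → ℝ} (hw : ∀ i, Measurable fun a => w a i)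
    (h0 : ∀ a i, 0 < w a i) : IsMarkovMap fun a => categorical (w a) :=
  isMarkovMap_sum_dirac
    (fun i => ((hw i).div (Finset.measurable_sum _ fun j _ => hw j)).ennreal_ofReal)
    (fun a => sum_ofReal_div_sum (h0 a)) fun _ => measurable_const

end Categorical

/-! ### Gaussian laws: densities and dependence on the parameters. -/

section Gaussian

variable {D : ℕ}

theorem gaussianDensity_pos (m : State D) {S : Matrix (Fin D) (Fin D) ℝ} (hS : S.PosDef)
    (x : State D) : 0 < gaussianDensity m S x := by
  have h : 0 < ((2 * Real.pi) • S).det := (hS.smul (by positivity)).det_pos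
  unfold gaussianDensity
  positivity

theorem measurable_det {α : Type*} [MeasurableSpace α] {n : Type*} [Fintype n] [DecidableEq n]
    {S : α → Matrix n n ℝ} (hS : ∀ i j, Measurable fun a => S a i j) :
    Measurable fun a => (S a).det := by
  simp_rw [Matrix.det_apply']
  exact Finset.measurable_sum _ fun σ _ =>
    (Finset.measurable_prod _ fun i _ => hS _ _).const_mul _

/-- The inverse is the adjugate divided by the determinant. The formula also gives the default value
at singular matrices, so no invertibility is needed. -/
theorem measurable_inv_apply {α : Type*} [MeasurableSpace α] {n : Type*} [Fintype n] [DecidableEq n]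
    {S : α → Matrix n n ℝ} (hS : ∀ i j, Measurable fun a => S a i j) (i j : n) :
    Measurable fun a => (S a)⁻¹ i j := by
  simp_rw [Matrix.inv_def, Matrix.smul_apply, Matrix.adjugate_apply, Ring.inverse_eq_inv, smul_eq_mul]
  refine (measurable_det hS).inv.mul (measurable_det fun k l => ?_)
  by_cases h : k = j
  · subst h; simp
  · simp [h, hS]

theorem measurable_mul_apply {α : Type*} [MeasurableSpace α] {l m n : Type*} [Fintype m]
    {S : α → Matrix l m ℝ} {R : α → Matrix m n ℝ} (hS : ∀ i j, Measurable fun a => S a i j)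
    (hR : ∀ i j, Measurable fun a => R a i j) (i : l) (j : n) :
    Measurable fun a => (S a * R a) i j := by
  simp_rw [Matrix.mul_apply]
  exact Finset.measurable_sum _ fun k _ => (hS _ _).mul (hR _ _)

theorem measurable_mulVec {α : Type*} [MeasurableSpace α] {m n : Type*} [Fintype n]
    {S : α → Matrix m n ℝ} {v : α → n → ℝ} (hS : ∀ i j, Measurable fun a => S a i j)
    (hv : Measurable v) : Measurable fun a => (S a).mulVec (v a) := by
  refine measurable_pi_lambda _ fun i => ?_
  simp_rw [Matrix.mulVec, dotProduct]
  exact Finset.measurable_sum _ fun k _ => (hS _ _).mul ((measurable_pi_apply k).comp hv)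

theorem measurable_gaussianDensity {α : Type*} [MeasurableSpace α] {m x : α → State D}
    {S : α → Matrix (Fin D) (Fin D) ℝ} (hm : Measurable m)
    (hS : ∀ i j, Measurable fun a => S a i j) (hx : Measurable x) :
    Measurable fun a => gaussianDensity (m a) (S a) (x a) := by
  have hd : Measurable fun a => (x a - m a).ofLp := by fun_prop
  unfold gaussianDensity
  refine (Real.continuous_sqrt.measurable.comp (measurable_det fun i j => ?_)).inv.mul
    (Real.measurable_exp.comp (Measurable.const_mul ?_ _))
  · exact (hS i j).const_mul _
  · have h := measurable_mulVec (measurable_inv_apply hS) hd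
    simp_rw [dotProduct]
    exact Finset.measurable_sum _ fun k _ =>
      ((measurable_pi_apply k).comp hd).mul ((measurable_pi_apply k).comp h)

theorem measurable_ofReal_gaussianDensity (m : State D) (S : Matrix (Fin D) (Fin D) ℝ) :
    Measurable fun x : State D => ENNReal.ofReal (gaussianDensity m S x) :=
  (measurable_gaussianDensity (m := fun _ => m) (S := fun _ => S) (x := fun x => x)
    measurable_const (fun _ _ => measurable_const) measurable_id).ennreal_ofReal

theorem gaussianDensity_zero_one (x : State D) :
    gaussianDensity 0 1 x = ∏ i, gaussianPDFReal 0 1 (x i) := by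
  simp only [gaussianDensity, gaussianPDFReal, Finset.prod_mul_distrib, ← Real.exp_sum]
  simp only [Matrix.det_smul, Matrix.det_one, Fintype.card_fin, sub_zero, inv_one, Matrix.one_mulVec,
    dotProduct, mul_one, NNReal.coe_one, Finset.prod_const, Finset.card_univ, Finset.mul_sum]
  congr 1
  · rw [inv_pow]
    congr 1
    rw [Real.sqrt_eq_iff_mul_self_eq (by positivity) (by positivity), ← mul_pow,
      Real.mul_self_sqrt (by positivity)]
  · congr 1
    exact Finset.sum_congr rfl fun i _ => by ring

theorem stdGaussian_eq_withDensity :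
    stdGaussian (State D) =
      volume.withDensity fun x => ENNReal.ofReal (gaussianDensity 0 1 x) := by
  have hg : gaussianReal 0 1 = volume.withDensity (gaussianPDF 0 1) :=
    gaussianReal_of_var_ne_zero 0 one_ne_zero
  have : SigmaFinite (volume.withDensity (gaussianPDF 0 1)) := hg ▸ inferInstance
  rw [← map_pi_eq_stdGaussian, hg, pi_withDensity fun _ => measurable_gaussianPDF 0 1]
  ext s hs
  rw [Measure.map_apply (by fun_prop) hs, withDensity_apply _ ((WithLp.measurable_toLp 2 _) hs),
    withDensity_apply _ hs,
    ← (PiLp.volume_preserving_toLp (Fin D)).setLIntegral_comp_preimage hs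
      (measurable_ofReal_gaussianDensity 0 1)]
  refine lintegral_congr fun x => ?_
  rw [gaussianDensity_zero_one, ENNReal.ofReal_prod_of_nonneg fun i _ => gaussianPDFReal_nonneg _ _ _]
  rfl

section Sqrt

open scoped MatrixOrder Matrix.Norms.L2Operator

/-- `R` is the symmetric square root through which `multivariateGaussian` is defined. Only the
listed algebraic facts are used afterwards. -/
theorem exists_sqrt_of_posDef {S : Matrix (Fin D) (Fin D) ℝ} (hS : S.PosDef) :
    ∃ R : Matrix (Fin D) (Fin D) ℝ, (∀ m, multivariateGaussian m S =
      (stdGaussian (State D)).map fun x => m + Matrix.toEuclideanCLM (𝕜 := ℝ) R x) ∧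
      R * R = S ∧ R.transpose = R ∧ 0 < R.det ∧ R.det = Real.sqrt S.det := by
  have hp : (CFC.sqrt S).PosSemidef := Matrix.nonneg_iff_posSemidef.1 (CFC.sqrt_nonneg S)
  have hdet : (CFC.sqrt S).det = Real.sqrt S.det := by
    simpa [RCLike.sqrt_of_nonneg hS.det_pos.le] using hS.posSemidef.det_sqrt
  exact ⟨CFC.sqrt S, fun m => rfl, CFC.sqrt_mul_sqrt_self S hS.posSemidef.nonneg,
    (Matrix.conjTranspose_eq_transpose_of_trivial _).symm.trans hp.isHermitian.eq,
    hdet ▸ Real.sqrt_pos.2 hS.det_pos, hdet⟩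

end Sqrt

theorem map_add_toEuclideanCLM_volume (m : State D) {R : Matrix (Fin D) (Fin D) ℝ}
    (hdet : 0 < R.det) :
    (volume : Measure (State D)).map (fun x => m + Matrix.toEuclideanCLM (𝕜 := ℝ) R x) =
      ENNReal.ofReal (R.det)⁻¹ • volume := by
  have hLdet : LinearMap.det (Matrix.toEuclideanLin R) = R.det := by
    rw [Matrix.toEuclideanLin, Matrix.toLpLin_eq_toLin]
    exact LinearMap.det_toLin _ _
  have h1 := Measure.map_linearMap_addHaar_eq_smul_addHaar (volume : Measure (State D))
    (f := Matrix.toEuclideanLin R) (by rw [hLdet]; exact hdet.ne')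
  rw [hLdet, abs_of_pos (inv_pos.2 hdet)] at h1
  have h2 : (fun x : State D => m + Matrix.toEuclideanCLM (𝕜 := ℝ) R x) =
    (fun x => m + x) ∘ Matrix.toEuclideanLin R := rfl
  have h3 : Measurable (Matrix.toEuclideanLin R : State D → State D) :=
    (LinearMap.continuous_of_finiteDimensional _).measurable
  rw [h2, ← Measure.map_map (by fun_prop) h3, h1, Measure.map_smul, map_add_left_eq_self]

/-- Whitening: `R S⁻¹ R = 1` since `S = R * R` with `R` symmetric, and the normalising constants
differ by `√det S = det R`. -/
theorem gaussianDensity_add_toEuclideanCLM (m x : State D) {S R : Matrix (Fin D) (Fin D) ℝ}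
    (hRS : R * R = S) (hRt : R.transpose = R) (hdet : 0 < R.det) (hRdet : R.det = Real.sqrt S.det) :
    gaussianDensity 0 1 x =
      R.det * gaussianDensity m S (m + Matrix.toEuclideanCLM (𝕜 := ℝ) R x) := by
  have hq : (R.mulVec x.ofLp) ⬝ᵥ (S⁻¹).mulVec (R.mulVec x.ofLp) = x.ofLp ⬝ᵥ x.ofLp := by
    rw [Matrix.mulVec_mulVec, ← hRS, Matrix.mul_inv_rev, Matrix.mul_assoc,
      Matrix.nonsing_inv_mul _ hdet.ne'.isUnit, Matrix.mul_one, Matrix.dotProduct_mulVec,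
      ← Matrix.mulVec_transpose, Matrix.mulVec_mulVec, Matrix.transpose_nonsing_inv, hRt,
      Matrix.nonsing_inv_mul _ hdet.ne'.isUnit, Matrix.one_mulVec]
  have hL : (Matrix.toEuclideanCLM (𝕜 := ℝ) R x).ofLp = R.mulVec x.ofLp := rfl
  simp only [gaussianDensity, add_sub_cancel_left, hL, hq, Matrix.det_smul, Matrix.det_one,
    sub_zero, inv_one, Matrix.one_mulVec, mul_one]
  rw [Real.sqrt_mul (by positivity), ← hRdet, mul_inv, ← mul_assoc, mul_left_comm,
    mul_inv_cancel₀ hdet.ne', mul_one]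

/-- Change of variables `x ↦ m + R x` from the standard Gaussian: the factor `det R` from the
density cancels the factor `(det R)⁻¹` from the image of Lebesgue measure. -/
theorem multivariateGaussian_eq_withDensity (m : State D) {S : Matrix (Fin D) (Fin D) ℝ}
    (hS : S.PosDef) :
    multivariateGaussian m S =
      volume.withDensity fun x => ENNReal.ofReal (gaussianDensity m S x) := by
  obtain ⟨R, hR, hRS, hRt, hdet, hRdet⟩ := exists_sqrt_of_posDef hS
  have hφ : Measurable fun x : State D => m + Matrix.toEuclideanCLM (𝕜 := ℝ) R x := by fun_prop
  have hm := measurable_ofReal_gaussianDensity m S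
  rw [hR, stdGaussian_eq_withDensity]
  ext s hs
  rw [Measure.map_apply hφ hs, withDensity_apply _ (hφ hs), withDensity_apply _ hs]
  simp_rw [gaussianDensity_add_toEuclideanCLM m _ hRS hRt hdet hRdet, ENNReal.ofReal_mul hdet.le]
  have hmφ : Measurable fun x : State D => ENNReal.ofReal (gaussianDensity m S
      (m + Matrix.toEuclideanCLM (𝕜 := ℝ) R x)) := hm.comp hφ
  rw [lintegral_const_mul _ hmφ, ← setLIntegral_map hs hm hφ,
    map_add_toEuclideanCLM_volume m hdet,
    Measure.restrict_smul, lintegral_smul_measure, smul_eq_mul, ← mul_assoc,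
    ← ENNReal.ofReal_mul hdet.le, mul_inv_cancel₀ hdet.ne', ENNReal.ofReal_one, one_mul]

/-- Measurability in the covariance is read off the density, so that of the matrix square root is
not needed. -/
theorem isMarkovMap_multivariateGaussian {α : Type*} [MeasurableSpace α] {m : α → State D}
    {S : α → Matrix (Fin D) (Fin D) ℝ} (hm : Measurable m)
    (hS : ∀ i j, Measurable fun a => S a i j) (hp : ∀ a, (S a).PosDef) :
    IsMarkovMap fun a => multivariateGaussian (m a) (S a) := by
  refine ⟨Measure.measurable_of_measurable_coe _ fun s hs => ?_, fun a => inferInstance⟩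
  simp_rw [fun a => multivariateGaussian_eq_withDensity (m a) (hp a), withDensity_apply _ hs]
  exact Measurable.lintegral_prod_right' (f := fun p : α × State D =>
    ENNReal.ofReal (gaussianDensity (m p.1) (S p.1) p.2)) (measurable_gaussianDensity
      (hm.comp measurable_fst) (fun i j => (hS i j).comp measurable_fst) measurable_snd).ennreal_ofReal

end Gaussian

/-! ### Reading and replacing single states of a path. -/

section Coordinates

variable {T D : ℕ}

theorem coord_of_mem (x : StatePath T D) {t : ℕ} (ht : 1 ≤ t ∧ t ≤ T) :
    coord x t = x ⟨t - 1, by omega⟩ := dif_pos ht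

theorem coord_of_not_mem (x : StatePath T D) {t : ℕ} (ht : ¬(1 ≤ t ∧ t ≤ T)) : coord x t = 0 :=
  dif_neg ht

theorem coord_setCoord_of_ne (x : StatePath T D) {s t : ℕ} (h : s ≠ t) (y : State D) :
    coord (setCoord x t y) s = coord x s := by
  by_cases hs : 1 ≤ s ∧ s ≤ T
  · rw [coord_of_mem _ hs, coord_of_mem _ hs, setCoord, if_neg]
    simp only
    omega
  · rw [coord_of_not_mem _ hs, coord_of_not_mem _ hs]

theorem coord_setCoord_self (x : StatePath T D) {t : ℕ} (ht : 1 ≤ t ∧ t ≤ T) (y : State D) :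
    coord (setCoord x t y) t = y := by
  rw [coord_of_mem _ ht, setCoord, if_pos]
  simp only
  omega

theorem setCoord_eq_update (x : StatePath T D) {t : ℕ} (ht : t < T) (y : State D) :
    setCoord x (t + 1) y = Function.update x ⟨t, ht⟩ y := by
  funext s
  by_cases hs : s = ⟨t, ht⟩
  · subst hs; simp [setCoord]
  · rw [Function.update_of_ne hs, setCoord, if_neg]
    rw [Fin.ext_iff] at hs
    simpa using hs

@[fun_prop]
theorem measurable_coord (t : ℕ) : Measurable fun x : StatePath T D => coord x t := by
  by_cases ht : 1 ≤ t ∧ t ≤ T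
  · simp_rw [coord_of_mem _ ht]; exact measurable_pi_apply _
  · simp_rw [coord_of_not_mem _ ht]; exact measurable_const

theorem measurable_setCoord {α : Type*} [MeasurableSpace α] {x : α → StatePath T D}
    {y : α → State D} (hx : Measurable x) (t : ℕ) (hy : Measurable y) :
    Measurable fun a => setCoord (x a) t (y a) := by
  refine measurable_pi_lambda _ fun s => ?_
  unfold setCoord
  split_ifs
  · exact hy
  · exact (measurable_pi_apply s).comp hx

end Coordinates

/-- Used to follow random ancestors and selected indices: evaluation at a random index is jointly
measurable when there are countably many indices. -/
theorem measurable_apply_of_countable {α ι X : Type*} [MeasurableSpace α] [MeasurableSpace ι]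
    [Countable ι] [MeasurableSingletonClass ι] [MeasurableSpace X] {f : α → ι → X} {i : α → ι}
    (hf : Measurable f) (hi : Measurable i) : Measurable fun a => f a (i a) := by
  have h : Measurable fun p : (ι → X) × ι => p.1 p.2 :=
    measurable_from_prod_countable_left fun i => measurable_pi_apply i
  exact h.comp (hf.prodMk hi)

/-- The conditions on an auxiliary model under which the algorithm is well defined. -/
structure AuxModel.Regular {D : ℕ} (A : AuxModel D) (T : ℕ) : Prop where
  measurable_mean : ∀ t ∈ Finset.Icc 1 T, Measurable fun p : State D × State D => A.mean t p.1 p.2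
  measurable_cov : ∀ t ∈ Finset.Icc 1 T, ∀ i j, Measurable fun x => A.cov t x i j
  posDef_cov : ∀ t ∈ Finset.Icc 1 T, ∀ x, (A.cov t x).PosDef
  measurable_pot : ∀ t ∈ Finset.Icc 1 T,
    Measurable fun p : State D × State D × State D × State D × State D =>
      A.pot t p.1 p.2.1 p.2.2.1 p.2.2.2.1 p.2.2.2.2
  pot_pos : ∀ t ∈ Finset.Icc 1 T, ∀ x2 x1 x0 u1 u0, 0 < A.pot t x2 x1 x0 u1 u0

/-! ### The algorithm as a composition of Markov kernels. -/

section Measurability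

variable {T N D : ℕ} {A : AuxModel D} {α : Type*} [MeasurableSpace α]
  {u x : α → StatePath T D} {g : α → Gen N D} {t : ℕ}

theorem AuxModel.Regular.measurable_pot_comp (hA : A.Regular T) (ht : t ∈ Finset.Icc 1 T)
    {x2 x1 x0 u1 u0 : α → State D} (h2 : Measurable x2) (h1 : Measurable x1) (h0 : Measurable x0)
    (hu1 : Measurable u1) (hu0 : Measurable u0) :
    Measurable fun a => A.pot t (x2 a) (x1 a) (x0 a) (u1 a) (u0 a) :=
  (hA.measurable_pot t ht).comp (h2.prodMk (h1.prodMk (h0.prodMk (hu1.prodMk hu0))))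

theorem AuxModel.Regular.measurable_incr_comp (hA : A.Regular T) (ht : t ∈ Finset.Icc 1 T)
    {x2 x1 x0 u1 u0 : α → State D} (h2 : Measurable x2) (h1 : Measurable x1) (h0 : Measurable x0)
    (hu1 : Measurable u1) (hu0 : Measurable u0) :
    Measurable fun a => A.incr t (x2 a) (x1 a) (x0 a) (u1 a) (u0 a) :=
  (measurable_gaussianDensity ((hA.measurable_mean t ht).comp (h1.prodMk hu0))
    (fun i j => (hA.measurable_cov t ht i j).comp h1) h0).mul
    (hA.measurable_pot_comp ht h2 h1 h0 hu1 hu0)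

theorem AuxModel.Regular.mutationDensity_pos (hA : A.Regular T) (ht : t ∈ Finset.Icc 1 T)
    (x1 u x0 : State D) : 0 < A.mutationDensity t x1 u x0 :=
  gaussianDensity_pos _ (hA.posDef_cov t ht x1) _

theorem AuxModel.Regular.incr_pos (hA : A.Regular T) (ht : t ∈ Finset.Icc 1 T)
    (x2 x1 x0 u1 u0 : State D) : 0 < A.incr t x2 x1 x0 u1 u0 :=
  mul_pos (hA.mutationDensity_pos ht _ _ _) (hA.pot_pos t ht _ _ _ _ _)

theorem AuxModel.Regular.mutation_eq_withDensity (hA : A.Regular T) (ht : t ∈ Finset.Icc 1 T)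
    (x1 u : State D) : A.mutation t x1 u =
      volume.withDensity fun x0 => ENNReal.ofReal (A.mutationDensity t x1 u x0) :=
  multivariateGaussian_eq_withDensity _ (hA.posDef_cov t ht x1)

theorem AuxModel.Regular.isMarkovMap_mutation (hA : A.Regular T) (ht : t ∈ Finset.Icc 1 T)
    {x1 u : α → State D} (hx : Measurable x1) (hu : Measurable u) :
    IsMarkovMap fun a => A.mutation t (x1 a) (u a) :=
  isMarkovMap_multivariateGaussian ((hA.measurable_mean t ht).comp (hx.prodMk hu))
    (fun i j => (hA.measurable_cov t ht i j).comp hx) fun _ => hA.posDef_cov t ht _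

theorem AuxModel.Regular.weight_pos (hA : A.Regular T) (ht : t ∈ Finset.Icc 1 T)
    (u : StatePath T D) (g : Gen N D) (n : Fin (N + 1)) : 0 < weight A u t g n :=
  hA.pot_pos t ht _ _ _ _ _

theorem AuxModel.Regular.sum_weight_pos (hA : A.Regular T) (ht : t ∈ Finset.Icc 1 T)
    (u : StatePath T D) (g : Gen N D) : 0 < ∑ n, weight A u t g n :=
  Finset.sum_pos (fun n _ => hA.weight_pos ht u g n) Finset.univ_nonempty

theorem AuxModel.Regular.normWeight_pos (hA : A.Regular T) (ht : t ∈ Finset.Icc 1 T)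
    (u : StatePath T D) (g : Gen N D) (n : Fin (N + 1)) : 0 < normWeight A u t g n :=
  div_pos (hA.weight_pos ht u g n) (hA.sum_weight_pos ht u g)

theorem AuxModel.Regular.sum_normWeight (hA : A.Regular T) (ht : t ∈ Finset.Icc 1 T)
    (u : StatePath T D) (g : Gen N D) : ∑ n, normWeight A u t g n = 1 := by
  simp only [normWeight]
  rw [← Finset.sum_div, div_self (hA.sum_weight_pos ht u g).ne']

theorem measurable_lineage (hg : Measurable g) (n : Fin (N + 1)) :
    Measurable fun a => (g a).2 n :=
  (measurable_pi_apply n).comp (measurable_snd.comp hg)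

theorem AuxModel.Regular.measurable_weight (hA : A.Regular T) (ht : t ∈ Finset.Icc 1 T)
    (hu : Measurable u) (hg : Measurable g) (n : Fin (N + 1)) :
    Measurable fun a => weight A (u a) t (g a) n := by
  have h := measurable_lineage hg n
  exact hA.measurable_pot_comp ht h.fst h.snd.fst h.snd.snd ((measurable_coord _).comp hu)
    ((measurable_coord _).comp hu)

theorem AuxModel.Regular.measurable_normWeight (hA : A.Regular T) (ht : t ∈ Finset.Icc 1 T)
    (hu : Measurable u) (hg : Measurable g) (n : Fin (N + 1)) :
    Measurable fun a => normWeight A (u a) t (g a) n :=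
  (hA.measurable_weight ht hu hg n).div
    (Finset.measurable_sum _ fun m _ => hA.measurable_weight ht hu hg m)

theorem isMarkovMap_const {β : Type*} [MeasurableSpace β] (μ : Measure β) [h : IsProbabilityMeasure μ] :
    IsMarkovMap fun _ : α => μ :=
  ⟨measurable_const, fun _ => h⟩

theorem IsMarkovMap.ite_eq {β ι : Type*} [MeasurableSpace β] [MeasurableSpace ι]
    [MeasurableSingletonClass ι] [DecidableEq ι] {μ ν : α → Measure β} (hμ : IsMarkovMap μ)
    (hν : IsMarkovMap ν) (n : ι) {k : α → ι} (hk : Measurable k) :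
    IsMarkovMap fun a => if n = k a then μ a else ν a := by
  refine ⟨Measurable.ite ?_ hμ.1 hν.1, fun a => ?_⟩
  · have : {a | n = k a} = k ⁻¹' {n} := by ext a; simp [eq_comm]
    rw [this]
    exact hk (measurableSet_singleton n)
  · have := hμ.2 a
    have := hν.2 a
    dsimp only
    split_ifs <;> infer_instance

theorem isMarkovMap_uniform : IsMarkovMap fun _ : α => categorical fun _ : Fin (N + 1) => 1 :=
  isMarkovMap_categorical (fun _ => measurable_const) fun _ _ => one_pos

theorem AuxModel.Regular.isMarkovMap_firstGen (hA : A.Regular T) (hT : 1 ≤ T) (hu : Measurable u)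
    (hx : Measurable x) : IsMarkovMap fun a => firstGen N A (u a) (x a) := by
  have h1 : 1 ∈ Finset.Icc 1 T := Finset.mem_Icc.2 ⟨le_rfl, hT⟩
  refine isMarkovMap_uniform.bind (IsMarkovMap.bind (IsMarkovMap.pi fun n => ?_)
    (isMarkovMap_dirac ?_))
  · exact IsMarkovMap.ite_eq
      (isMarkovMap_dirac ((measurable_coord 1).comp (hx.comp measurable_fst)))
      (hA.isMarkovMap_mutation h1 measurable_const ((measurable_coord 1).comp (hu.comp measurable_fst)))
      n measurable_snd
  · fun_prop

theorem AuxModel.Regular.isMarkovMap_nextGen (hA : A.Regular T) (ht : t ∈ Finset.Icc 1 T)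
    (ht1 : t + 1 ∈ Finset.Icc 1 T) (hu : Measurable u) (hx : Measurable x) (hg : Measurable g) :
    IsMarkovMap fun a => nextGen A (u a) (x a) t (g a) := by
  refine isMarkovMap_uniform.bind (IsMarkovMap.bind (IsMarkovMap.pi fun n => ?_)
    (IsMarkovMap.bind (IsMarkovMap.pi fun n => ?_) (isMarkovMap_dirac ?_)))
  · exact IsMarkovMap.ite_eq (isMarkovMap_dirac (hg.comp measurable_fst).fst)
      (isMarkovMap_categorical
        (hA.measurable_normWeight ht (hu.comp measurable_fst) (hg.comp measurable_fst))
        fun _ => hA.normWeight_pos ht _ _) n measurable_snd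
  · refine IsMarkovMap.ite_eq
      (isMarkovMap_dirac ((measurable_coord _).comp (hx.comp measurable_fst.fst)))
      (hA.isMarkovMap_mutation ht1 ?_ ((measurable_coord _).comp (hu.comp measurable_fst.fst)))
      n measurable_fst.snd
    exact (measurable_apply_of_countable (hg.comp measurable_fst.fst).snd
      ((measurable_pi_apply n).comp measurable_snd)).snd.snd
  · refine (measurable_fst.fst.snd).prodMk (measurable_pi_lambda _ fun n => ?_)
    have h := measurable_apply_of_countable
      (f := fun p : ((α × Fin (N + 1)) × (Fin (N + 1) → Fin (N + 1))) × (Fin (N + 1) → State D) =>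
        (g p.1.1.1).2) (i := fun p => p.1.2 n) (hg.comp measurable_fst.fst.fst).snd
      ((measurable_pi_apply n).comp measurable_fst.snd)
    exact h.snd.fst.prodMk (h.snd.snd.prodMk ((measurable_pi_apply n).comp measurable_snd))

theorem AuxModel.Regular.isMarkovMap_backward (hA : A.Regular T) (ht : t ∈ Finset.Icc 1 T)
    (ht1 : t + 1 ∈ Finset.Icc 1 T) (hu : Measurable u) (hx : Measurable x) (hg : Measurable g) :
    IsMarkovMap fun a => backward A (u a) t (g a) (x a) := by
  have hc : ∀ s, Measurable fun a => coord (x a) s := fun s => (measurable_coord s).comp hx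
  have hcu : ∀ s, Measurable fun a => coord (u a) s := fun s => (measurable_coord s).comp hu
  refine isMarkovMap_categorical (fun i => ?_) fun _ i => ?_
  · have h := measurable_lineage hg i
    refine ((hA.measurable_normWeight ht hu hg i).mul
      (hA.measurable_incr_comp ht1 h.snd.fst h.snd.snd (hc _) (hcu _) (hcu _))).mul ?_
    split_ifs with h2
    · exact hA.measurable_incr_comp (Finset.mem_Icc.2 ⟨by omega, h2⟩) h.snd.snd (hc _) (hc _) (hcu _)
        (hcu _)
    · exact measurable_const
  · refine mul_pos (mul_pos (hA.normWeight_pos ht _ _ _) (hA.incr_pos ht1 _ _ _ _ _)) ?_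
    split_ifs with h2
    · exact hA.incr_pos (Finset.mem_Icc.2 ⟨by omega, h2⟩) _ _ _ _ _
    · exact one_pos

theorem sum_erase_eq_sum_ite {ι M : Type*} [Fintype ι] [DecidableEq ι] [AddCommMonoid M] (k : ι)
    (f : ι → M) : ∑ i ∈ Finset.univ.erase k, f i = ∑ i, if i = k then 0 else f i := by
  rw [← Finset.sum_erase Finset.univ (a := k) (f := fun i => if i = k then 0 else f i) (if_pos rfl)]
  exact Finset.sum_congr rfl fun i hi => (if_neg (Finset.ne_of_mem_erase hi)).symm

/-- There are at least two particles and all weights are positive, so no weight reaches one. This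
makes the proposal and the acceptance ratio of the forced move well defined. -/
theorem one_sub_pos_of_sum_eq_one (hN : 1 ≤ N) {W : Fin (N + 1) → ℝ} (h0 : ∀ i, 0 < W i)
    (h1 : ∑ i, W i = 1) (k : Fin (N + 1)) : 0 < 1 - W k := by
  have : Nontrivial (Fin (N + 1)) := Fin.nontrivial_iff_two_le.2 (by omega)
  obtain ⟨j, hj⟩ := exists_ne k
  have := Finset.sum_erase_eq_sub (f := W) (Finset.mem_univ k)
  rw [h1] at this
  rw [← this]
  exact Finset.sum_pos (fun i _ => h0 i) ⟨j, Finset.mem_erase.2 ⟨hj, Finset.mem_univ j⟩⟩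

theorem sum_erase_ofReal_div (hN : 1 ≤ N) {W : Fin (N + 1) → ℝ} (h0 : ∀ i, 0 < W i)
    (h1 : ∑ i, W i = 1) (k : Fin (N + 1)) :
    ∑ i ∈ Finset.univ.erase k, ENNReal.ofReal (W i / (1 - W k)) = 1 := by
  have hk := one_sub_pos_of_sum_eq_one hN h0 h1 k
  rw [← ENNReal.ofReal_sum_of_nonneg fun i _ => (div_pos (h0 i) hk).le, ← Finset.sum_div,
    Finset.sum_erase_eq_sub (Finset.mem_univ k), h1, div_self hk.ne', ENNReal.ofReal_one]

theorem ofReal_min_add_ofReal (hN : 1 ≤ N) {W : Fin (N + 1) → ℝ} (h0 : ∀ i, 0 < W i)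
    (h1 : ∑ i, W i = 1) (i k : Fin (N + 1)) :
    ENNReal.ofReal (min 1 ((1 - W k) / (1 - W i))) +
      ENNReal.ofReal (1 - min 1 ((1 - W k) / (1 - W i))) = 1 := by
  have h := div_pos (one_sub_pos_of_sum_eq_one hN h0 h1 k) (one_sub_pos_of_sum_eq_one hN h0 h1 i)
  rw [← ENNReal.ofReal_add (le_min zero_le_one h.le) (sub_nonneg.2 (min_le_left _ _)),
    add_sub_cancel, ENNReal.ofReal_one]

theorem isMarkovMap_forcedMove (hN : 1 ≤ N) {W : α → Fin (N + 1) → ℝ} {k : α → Fin (N + 1)}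
    (hW : Measurable W) (hk : Measurable k) (h0 : ∀ a i, 0 < W a i) (h1 : ∀ a, ∑ i, W a i = 1) :
    IsMarkovMap fun a => forcedMove (W a) (k a) := by
  have hWi : ∀ i, Measurable fun a => W a i := fun i => (measurable_pi_apply i).comp hW
  have hWk : Measurable fun a => W a (k a) := measurable_apply_of_countable hW hk
  refine IsMarkovMap.bind ?_ ?_
  · have h : ∀ a, (∑ i ∈ Finset.univ.erase (k a),
        ENNReal.ofReal (W a i / (1 - W a (k a))) • Measure.dirac i) =
          ∑ i, (if i = k a then 0 else ENNReal.ofReal (W a i / (1 - W a (k a)))) •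
            Measure.dirac i := by
      intro a
      rw [sum_erase_eq_sum_ite]
      exact Finset.sum_congr rfl fun i _ => by split_ifs <;> simp
    simp_rw [h]
    refine isMarkovMap_sum_dirac (fun i => Measurable.ite ?_ measurable_const ?_) (fun a => ?_)
      fun _ => measurable_const
    · have : {a | i = k a} = k ⁻¹' {i} := by ext a; simp [eq_comm]
      rw [this]
      exact hk (measurableSet_singleton i)
    · exact ((hWi i).div (measurable_const.sub hWk)).ennreal_ofReal
    · rw [← sum_erase_ofReal_div hN (h0 a) (h1 a) (k a), sum_erase_eq_sum_ite]
  · have h2 : Measurable fun p : α × Fin (N + 1) =>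
        min 1 ((1 - W p.1 (k p.1)) / (1 - W p.1 p.2)) :=
      measurable_const.min ((measurable_const.sub (hWk.comp measurable_fst)).div
        (measurable_const.sub
          (measurable_apply_of_countable (hW.comp measurable_fst) measurable_snd)))
    have h := isMarkovMap_sum_dirac (ι := Fin 2) (α := α × Fin (N + 1))
      (p := fun p => ![ENNReal.ofReal (min 1 ((1 - W p.1 (k p.1)) / (1 - W p.1 p.2))),
        ENNReal.ofReal (1 - min 1 ((1 - W p.1 (k p.1)) / (1 - W p.1 p.2)))])
      (g := fun p => ![p.2, k p.1]) ?_ ?_ ?_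
    · simpa [Fin.sum_univ_two, Function.uncurry_def] using h
    · exact Fin.forall_fin_two.2 ⟨h2.ennreal_ofReal, (measurable_const.sub h2).ennreal_ofReal⟩
    · intro a
      rw [Fin.sum_univ_two]
      exact ofReal_min_add_ofReal hN (h0 a.1) (h1 a.1) _ _
    · exact Fin.forall_fin_two.2 ⟨measurable_snd, hk.comp measurable_fst⟩

/-- The parameter space is quantified inside the induction, because the recursive call is made with
the new generation adjoined to it. -/
theorem AuxModel.Regular.isMarkovMap_sweep (hA : A.Regular T) (hN : 1 ≤ N) {r : ℕ} :
    ∀ {t : ℕ}, 1 ≤ t → t + r = T → ∀ {α : Type*} [MeasurableSpace α] {u x : α → StatePath T D}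
      {g : α → Gen N D}, Measurable u → Measurable x → Measurable g →
      IsMarkovMap fun a => sweep A (u a) (x a) r t (g a) := by
  induction r with
  | zero =>
    intro t ht htT α _ u x g hu hx hg
    have htm : t ∈ Finset.Icc 1 T := Finset.mem_Icc.2 ⟨ht, by omega⟩
    refine (isMarkovMap_forcedMove hN
      (measurable_pi_lambda _ (hA.measurable_normWeight htm hu hg)) hg.fst
      (fun a => hA.normWeight_pos htm _ _) fun a => hA.sum_normWeight htm _ _).bind
      (isMarkovMap_dirac (measurable_setCoord measurable_const t ?_))
    exact (measurable_apply_of_countable (hg.comp measurable_fst).snd measurable_snd).snd.snd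
  | succ r ih =>
    intro t ht htT α _ u x g hu hx hg
    have htm : t ∈ Finset.Icc 1 T := Finset.mem_Icc.2 ⟨ht, by omega⟩
    have htm1 : t + 1 ∈ Finset.Icc 1 T := Finset.mem_Icc.2 ⟨by omega, by omega⟩
    refine (hA.isMarkovMap_nextGen htm htm1 hu hx hg).bind (IsMarkovMap.bind
      (ih (by omega) (by omega) (hu.comp measurable_fst) (hx.comp measurable_fst) measurable_snd)
      (IsMarkovMap.bind (hA.isMarkovMap_backward htm htm1 (hu.comp measurable_fst.fst)
        measurable_snd (hg.comp measurable_fst.fst))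
        (isMarkovMap_dirac (measurable_setCoord measurable_fst.snd t ?_))))
    exact (measurable_apply_of_countable (hg.comp measurable_fst.fst.fst).snd
      measurable_snd).snd.snd

theorem AuxModel.Regular.isMarkovMap_csmc (hA : A.Regular T) (hN : 1 ≤ N) (hT : 1 ≤ T)
    (hu : Measurable u) (hx : Measurable x) : IsMarkovMap fun a => csmc N A (u a) (x a) :=
  (hA.isMarkovMap_firstGen hT hu hx).bind (hA.isMarkovMap_sweep hN le_rfl (by omega)
    (hu.comp measurable_fst) (hx.comp measurable_fst) measurable_snd)

end Measurability

theorem lintegral_bind_of_measurable {α β : Type*} [MeasurableSpace α] [MeasurableSpace β]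
    {m : Measure α} {g : α → Measure β} (hg : Measurable g) {f : β → ℝ≥0∞} (hf : Measurable f) :
    ∫⁻ b, f b ∂m.bind g = ∫⁻ a, ∫⁻ b, f b ∂g a ∂m :=
  Measure.lintegral_bind hg.aemeasurable hf.aemeasurable

theorem IsMarkovMap.ite {α β : Type*} [MeasurableSpace α] [MeasurableSpace β] {μ ν : α → Measure β}
    (hμ : IsMarkovMap μ) (hν : IsMarkovMap ν) (c : Prop) [Decidable c] :
    IsMarkovMap fun a => if c then μ a else ν a := by
  split_ifs
  · exact hμ
  · exact hν

/-- Drawing an ancestor and a particle first and inserting them at the position `n₀` of an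
otherwise independently drawn generation is the same as drawing the generation. -/
theorem lintegral_resample {ι K Y : Type*} [Fintype ι] [DecidableEq ι] [Finite K]
    [MeasurableSpace K] [MeasurableSingletonClass K] [MeasurableSpace Y] (ν : Measure K)
    [IsProbabilityMeasure ν] (κ : K → Measure Y) [∀ k, IsProbabilityMeasure (κ k)] (n₀ : ι)
    {Θ : K → Y → (ι → K) → (ι → Y) → ℝ≥0∞}
    (hΘ : ∀ k a, Measurable fun p : Y × (ι → Y) => Θ k p.1 a p.2) :
    ∫⁻ k, ∫⁻ y, ∫⁻ a, ∫⁻ z, Θ k y a z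
        ∂Measure.pi (fun n => if n = n₀ then Measure.dirac y else κ (a n))
        ∂Measure.pi (fun n => if n = n₀ then Measure.dirac k else ν) ∂κ k ∂ν =
      ∫⁻ a, ∫⁻ z, Θ (a n₀) (z n₀) a z ∂Measure.pi (fun n => κ (a n))
        ∂Measure.pi (fun _ => ν) := by
  have h1 : ∀ k, ∫⁻ y, ∫⁻ a, ∫⁻ z, Θ k y a z
        ∂Measure.pi (fun n => if n = n₀ then Measure.dirac y else κ (a n))
        ∂Measure.pi (fun n => if n = n₀ then Measure.dirac k else ν) ∂κ k =
      ∫⁻ a, ∫⁻ y, ∫⁻ z, Θ k y a z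
        ∂Measure.pi (fun n => if n = n₀ then Measure.dirac y else κ (a n)) ∂κ k
        ∂Measure.pi (fun n => if n = n₀ then Measure.dirac k else ν) := by
    intro k
    refine lintegral_lintegral_swap (Measurable.aemeasurable ?_)
    refine measurable_from_prod_countable_left fun a => ?_
    refine IsMarkovMap.measurable_lintegral (m := fun y =>
      Measure.pi (fun n => if n = n₀ then Measure.dirac y else κ (a n)))
      (IsMarkovMap.pi fun n => ?_) (hΘ k a)
    exact (isMarkovMap_dirac measurable_id).ite (isMarkovMap_const _) _
  simp_rw [h1]
  -- With the ancestors integrated outside the particle `y`, the ancestor `k` is absorbed first. It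
  -- becomes `a n₀`, so `κ k` is then the law of the coordinate `n₀` and `y` is absorbed in the same
  -- way.
  rw [lintegral_lintegral_pi_ite_dirac (μ := fun _ : ι => ν) n₀
    (Θ := fun k a => ∫⁻ y, ∫⁻ z, Θ k y a z
      ∂Measure.pi (fun n => if n = n₀ then Measure.dirac y else κ (a n)) ∂κ k)
    (Measurable.of_discrete)]
  refine lintegral_congr fun a => ?_
  exact lintegral_lintegral_pi_ite_dirac (μ := fun n => κ (a n)) n₀ (hΘ (a n₀) a)

/-! ### Exchangeability of a generation with its reference particle. -/

section Generations

variable {T N D : ℕ} {A : AuxModel D} {u : StatePath T D} {t : ℕ}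

theorem lintegral_firstGen (x : StatePath T D) {f : Gen N D → ℝ≥0∞} (hf : Measurable f) :
    ∫⁻ g, f g ∂firstGen N A u x = ∫⁻ k, ∫⁻ z, f (k, fun n => (0, 0, z n))
      ∂Measure.pi (fun n => if n = k then Measure.dirac (coord x 1) else A.mutation 1 0 (coord u 1))
      ∂categorical fun _ : Fin (N + 1) => 1 := by
  rw [firstGen, lintegral_bind_of_measurable Measurable.of_discrete hf]
  refine lintegral_congr fun k => ?_
  have h : Measurable fun z : Fin (N + 1) → State D =>
      ((k, fun n => (0, 0, z n)) : Gen N D) := by fun_prop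
  refine (lintegral_bind_of_measurable (Measure.measurable_dirac.comp h) hf).trans ?_
  exact lintegral_congr fun z => lintegral_dirac' _ hf

/-- The lineages at the next time, for the ancestors `a` and the particles `z`. -/
noncomputable def extend (h : Fin (N + 1) → State D × State D × State D) (a : Fin (N + 1) → Fin (N + 1))
    (z : Fin (N + 1) → State D) : Fin (N + 1) → State D × State D × State D :=
  fun n => ((h (a n)).2.1, (h (a n)).2.2, z n)

theorem measurable_extend (h : Fin (N + 1) → State D × State D × State D)
    (a : Fin (N + 1) → Fin (N + 1)) : Measurable (extend h a) := by
  unfold extend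
  fun_prop

theorem lintegral_nextGen (x : StatePath T D) (g : Gen N D) {f : Gen N D → ℝ≥0∞}
    (hf : Measurable f) :
    ∫⁻ g', f g' ∂nextGen A u x t g = ∫⁻ k, ∫⁻ a, ∫⁻ z, f (k, extend g.2 a z)
      ∂Measure.pi (fun n => if n = k then Measure.dirac (coord x (t + 1))
        else A.mutation (t + 1) (g.2 (a n)).2.2 (coord u (t + 1)))
      ∂Measure.pi (fun n => if n = k then Measure.dirac g.1
        else categorical (normWeight A u t g))
      ∂categorical fun _ : Fin (N + 1) => 1 := by
  rw [nextGen, lintegral_bind_of_measurable Measurable.of_discrete hf]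
  refine lintegral_congr fun k => ?_
  rw [lintegral_bind_of_measurable Measurable.of_discrete hf]
  refine lintegral_congr fun a => ?_
  have h : Measurable fun z : Fin (N + 1) → State D => ((k, extend g.2 a z) : Gen N D) :=
    measurable_const.prodMk (measurable_extend _ _)
  refine (lintegral_bind_of_measurable (Measure.measurable_dirac.comp h) hf).trans ?_
  exact lintegral_congr fun z => lintegral_dirac' _ hf

/-- The law of the lineages at time `1` when all particles are drawn independently. -/
noncomputable def initialLineages (N : ℕ) (A : AuxModel D) (u : StatePath T D) :
    Measure (Fin (N + 1) → State D × State D × State D) :=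
  (Measure.pi fun _ => A.mutation 1 0 (coord u 1)).map fun z n => (0, 0, z n)

/-- The law of the lineages at time `t + 1` when all particles are drawn independently, given the
lineages at time `t`. -/
noncomputable def offspring (A : AuxModel D) (u : StatePath T D) (t : ℕ)
    (h : Fin (N + 1) → State D × State D × State D) :
    Measure (Fin (N + 1) → State D × State D × State D) :=
  (Measure.pi fun _ => categorical (normWeight A u t (0, h))).bind fun a =>
    (Measure.pi fun n => A.mutation (t + 1) (h (a n)).2.2 (coord u (t + 1))).map (extend h a)

theorem isProbabilityMeasure_mutation (x1 u : State D) :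
    IsProbabilityMeasure (A.mutation t x1 u) :=
  inferInstanceAs (IsProbabilityMeasure (multivariateGaussian _ _))

attribute [instance] isProbabilityMeasure_mutation

theorem isProbabilityMeasure_initialLineages :
    IsProbabilityMeasure (initialLineages N A u) :=
  Measure.isProbabilityMeasure_map (Measurable.aemeasurable (by fun_prop))

theorem isProbabilityMeasure_categorical {w : Fin (N + 1) → ℝ} (hw : ∀ i, 0 < w i) :
    IsProbabilityMeasure (categorical w) :=
  (isMarkovMap_categorical (α := Unit) (w := fun _ => w) (fun _ => measurable_const)
    fun _ => hw).2 ()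

theorem AuxModel.Regular.isProbabilityMeasure_categorical_normWeight (hA : A.Regular T)
    (ht : t ∈ Finset.Icc 1 T) (g : Gen N D) :
    IsProbabilityMeasure (categorical (normWeight A u t g)) :=
  isProbabilityMeasure_categorical fun i => hA.normWeight_pos ht u g i

theorem lintegral_offspring (h : Fin (N + 1) → State D × State D × State D)
    {f : (Fin (N + 1) → State D × State D × State D) → ℝ≥0∞} (hf : Measurable f) :
    ∫⁻ h', f h' ∂offspring A u t h = ∫⁻ a, ∫⁻ z, f (extend h a z)
      ∂Measure.pi (fun n => A.mutation (t + 1) (h (a n)).2.2 (coord u (t + 1)))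
      ∂Measure.pi fun _ => categorical (normWeight A u t (0, h)) := by
  rw [offspring, lintegral_bind_of_measurable Measurable.of_discrete hf]
  exact lintegral_congr fun a => lintegral_map hf (measurable_extend h a)

theorem AuxModel.Regular.isProbabilityMeasure_offspring (hA : A.Regular T)
    (ht : t ∈ Finset.Icc 1 T) (h : Fin (N + 1) → State D × State D × State D) :
    IsProbabilityMeasure (offspring A u t h) := by
  have := hA.isProbabilityMeasure_categorical_normWeight (u := u) ht ((0, h) : Gen N D)
  refine ⟨?_⟩
  rw [← lintegral_one, lintegral_offspring h measurable_const]
  simp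

/-- `Θ` sees the reference lineage and the generation. A reference state drawn from the mutation law
is just one more independent particle, so the lineage is recovered as the one with a uniform label.
-/
theorem lintegral_firstGen_eq_initialLineages (hT : 1 ≤ T)
    {Θ : State D × State D × State D → Gen N D → ℝ≥0∞} (hΘ : Measurable (Function.uncurry Θ)) :
    ∫⁻ y, ∫⁻ g, Θ (0, 0, y) g ∂firstGen N A u (setCoord 0 1 y) ∂A.mutation 1 0 (coord u 1) =
      ∫⁻ k, ∫⁻ h, Θ (h k) (k, h) ∂initialLineages N A u
        ∂categorical fun _ : Fin (N + 1) => 1 := by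
  have hy : ∀ y : State D, Measurable (Θ (0, 0, y)) := fun y =>
    hΘ.comp (measurable_const.prodMk measurable_id)
  have hm : ∀ k, Measurable fun p : State D × (Fin (N + 1) → State D) =>
      Θ (0, 0, p.1) (k, fun n => (0, 0, p.2 n)) := fun k =>
    hΘ.comp (f := fun p : State D × (Fin (N + 1) → State D) => ((0, 0, p.1), k, fun n => (0, 0, p.2 n)))
      (by fun_prop)
  simp_rw [fun y => lintegral_firstGen (A := A) (u := u) (setCoord 0 1 y) (hy y),
    coord_setCoord_self _ ⟨le_rfl, hT⟩]
  have := isProbabilityMeasure_categorical (w := fun _ : Fin (N + 1) => 1) fun _ => one_pos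
  rw [lintegral_lintegral_swap]
  · refine lintegral_congr fun k => ?_
    have hk : Measurable fun h : Fin (N + 1) → State D × State D × State D => Θ (h k) (k, h) :=
      hΘ.comp (f := fun h : Fin (N + 1) → State D × State D × State D => (h k, k, h)) (by fun_prop)
    rw [initialLineages, lintegral_map hk (by fun_prop)]
    exact lintegral_lintegral_pi_ite_dirac (μ := fun _ : Fin (N + 1) => A.mutation 1 0 (coord u 1)) k
      (Θ := fun y z => Θ (0, 0, y) (k, fun n => (0, 0, z n))) (hm k)
  · refine Measurable.aemeasurable (measurable_from_prod_countable_left fun k => ?_)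
    refine IsMarkovMap.measurable_lintegral (m := fun y =>
      Measure.pi (fun n => if n = k then Measure.dirac y else A.mutation 1 0 (coord u 1)))
      (IsMarkovMap.pi fun n => ?_) (hm k)
    exact (isMarkovMap_dirac measurable_id).ite (isMarkovMap_const _) _

/-- If the reference index at time `t` follows the weights and the next reference state follows the
mutation law, then the reference chooses its ancestor and its state exactly as the others do. Its
new position is therefore independent of a generation without a distinguished particle. -/
theorem AuxModel.Regular.lintegral_nextGen_eq_offspring (hA : A.Regular T)
    (ht : t ∈ Finset.Icc 1 T) (ht1 : t + 1 ∈ Finset.Icc 1 T)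
    (h : Fin (N + 1) → State D × State D × State D)
    {Θ : State D × State D × State D → Gen N D → ℝ≥0∞} (hΘ : Measurable (Function.uncurry Θ)) :
    ∑ k, ENNReal.ofReal (normWeight A u t (k, h) k) *
        ∫⁻ y, ∫⁻ g, Θ ((h k).2.1, (h k).2.2, y) g ∂nextGen A u (setCoord 0 (t + 1) y) t (k, h)
          ∂A.mutation (t + 1) (h k).2.2 (coord u (t + 1)) =
      ∫⁻ k, ∫⁻ h', Θ (h' k) (k, h') ∂offspring A u t h
        ∂categorical fun _ : Fin (N + 1) => 1 := by
  have hy : ∀ k y, Measurable (Θ ((h k).2.1, (h k).2.2, y)) := fun k y =>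
    hΘ.comp (measurable_const.prodMk measurable_id)
  have hm : ∀ k k' a, Measurable fun p : State D × (Fin (N + 1) → State D) =>
      Θ ((h k).2.1, (h k).2.2, p.1) (k', extend h a p.2) := fun k k' a =>
    hΘ.comp (f := fun p : State D × (Fin (N + 1) → State D) =>
      (((h k).2.1, (h k).2.2, p.1), k', extend h a p.2))
      ((measurable_const.prodMk (measurable_const.prodMk measurable_fst)).prodMk
        (measurable_const.prodMk ((measurable_extend h a).comp measurable_snd)))
  have := isProbabilityMeasure_categorical (w := fun _ : Fin (N + 1) => 1) fun _ => one_pos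
  have := hA.isProbabilityMeasure_categorical_normWeight (u := u) ht ((0, h) : Gen N D)
  -- The normalised weights sum to one, so `categorical` does not rescale them. They do not depend
  -- on the reference position, which may be set to `0`.
  have hW : ∀ F : Fin (N + 1) → ℝ≥0∞, ∑ k, ENNReal.ofReal (normWeight A u t (k, h) k) * F k =
      ∫⁻ k, F k ∂categorical (normWeight A u t ((0, h) : Gen N D)) := fun F => by
    rw [lintegral_categorical, hA.sum_normWeight ht]
    simp only [div_one]
    rfl
  rw [hW]
  simp_rw [fun k y => lintegral_nextGen (A := A) (u := u) (t := t) (setCoord 0 (t + 1) y) (k, h)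
    (hy k y), coord_setCoord_self _ (Finset.mem_Icc.1 ht1)]
  have hmy : ∀ k k' a, Measurable fun y => ∫⁻ z, Θ ((h k).2.1, (h k).2.2, y) (k', extend h a z)
      ∂Measure.pi (fun n => if n = k' then Measure.dirac y
        else A.mutation (t + 1) (h (a n)).2.2 (coord u (t + 1))) := by
    intro k k' a
    refine IsMarkovMap.measurable_lintegral (m := fun y => Measure.pi (fun n =>
      if n = k' then Measure.dirac y else A.mutation (t + 1) (h (a n)).2.2 (coord u (t + 1))))
      (IsMarkovMap.pi fun n => ?_) (hm k k' a)
    exact (isMarkovMap_dirac measurable_id).ite (isMarkovMap_const _) _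
  -- The uniform position is independent of the reference state and is moved outside, to be held
  -- fixed below.
  have h1 : ∀ k, ∫⁻ y, ∫⁻ k', ∫⁻ a, ∫⁻ z, Θ ((h k).2.1, (h k).2.2, y) (k', extend h a z)
      ∂Measure.pi (fun n => if n = k' then Measure.dirac y
        else A.mutation (t + 1) (h (a n)).2.2 (coord u (t + 1)))
      ∂Measure.pi (fun n => if n = k' then Measure.dirac k
        else categorical (normWeight A u t (k, h)))
      ∂(categorical fun _ : Fin (N + 1) => 1) ∂A.mutation (t + 1) (h k).2.2 (coord u (t + 1)) =
    ∫⁻ k', ∫⁻ y, ∫⁻ a, ∫⁻ z, Θ ((h k).2.1, (h k).2.2, y) (k', extend h a z)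
      ∂Measure.pi (fun n => if n = k' then Measure.dirac y
        else A.mutation (t + 1) (h (a n)).2.2 (coord u (t + 1)))
      ∂Measure.pi (fun n => if n = k' then Measure.dirac k
        else categorical (normWeight A u t (0, h)))
      ∂A.mutation (t + 1) (h k).2.2 (coord u (t + 1)) ∂categorical fun _ : Fin (N + 1) => 1 := by
    intro k
    refine lintegral_lintegral_swap (Measurable.aemeasurable
      (measurable_from_prod_countable_left fun k' => ?_))
    exact Measurable.lintegral_prod_right' (ν := Measure.pi (fun n => if n = k' then Measure.dirac k
        else categorical (normWeight A u t (0, h)))) (f := fun p : State D × (Fin (N + 1) → Fin (N + 1)) =>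
        ∫⁻ z, Θ ((h k).2.1, (h k).2.2, p.1) (k', extend h p.2 z)
          ∂Measure.pi (fun n => if n = k' then Measure.dirac p.1
            else A.mutation (t + 1) (h (p.2 n)).2.2 (coord u (t + 1))))
      (measurable_from_prod_countable_left fun a => hmy k k' a)
  simp_rw [h1]
  rw [lintegral_lintegral_swap Measurable.of_discrete.aemeasurable]
  refine lintegral_congr fun k' => ?_
  have hk : Measurable fun h : Fin (N + 1) → State D × State D × State D => Θ (h k') (k', h) :=
    hΘ.comp (f := fun h : Fin (N + 1) → State D × State D × State D => (h k', k', h)) (by fun_prop)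
  rw [lintegral_resample (categorical (normWeight A u t (0, h)))
    (fun k => A.mutation (t + 1) (h k).2.2 (coord u (t + 1))) k'
    (Θ := fun k y a z => Θ ((h k).2.1, (h k).2.2, y) (k', extend h a z)) fun k a => hm k k' a,
    lintegral_offspring h hk]
  rfl

end Generations

theorem measurable_lmarginal_param {α δ : Type*} {X : δ → Type*} [DecidableEq δ]
    [MeasurableSpace α] [∀ i, MeasurableSpace (X i)] {μ : ∀ i, Measure (X i)}
    [∀ i, SigmaFinite (μ i)] {s : Finset δ} {F : α → (∀ i, X i) → ℝ≥0∞}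
    (hF : Measurable (Function.uncurry F)) {x : α → ∀ i, X i} (hx : Measurable x) :
    Measurable fun a => (∫⋯∫⁻_s, F a ∂μ) (x a) :=
  Measurable.lintegral_prod_right' (f := fun p : α × (∀ i : s, X i) =>
    F p.1 (Function.updateFinset (x p.1) s p.2))
    (hF.comp (measurable_fst.prodMk (measurable_updateFinset'.comp
      ((hx.comp measurable_fst).prodMk measurable_snd))))

theorem lmarginal_lintegral {δ β : Type*} {X : δ → Type*} [DecidableEq δ]
    [MeasurableSpace β] [∀ i, MeasurableSpace (X i)] {μ : ∀ i, Measure (X i)}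
    [∀ i, SigmaFinite (μ i)] {s : Finset δ} {F : (∀ i, X i) → β → ℝ≥0∞}
    (hF : Measurable (Function.uncurry F)) (ν : Measure β) [SFinite ν] (x : ∀ i, X i) :
    (∫⋯∫⁻_s, (fun x => ∫⁻ b, F x b ∂ν) ∂μ) x = ∫⁻ b, (∫⋯∫⁻_s, (fun x => F x b) ∂μ) x ∂ν :=
  lintegral_lintegral_swap (Measurable.aemeasurable
    (hF.comp ((measurable_updateFinset.comp measurable_fst).prodMk measurable_snd)))

theorem lmarginal_sum_const_mul {δ ι : Type*} {X : δ → Type*} [DecidableEq δ]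
    [∀ i, MeasurableSpace (X i)] {μ : ∀ i, Measure (X i)} {s : Finset δ} (I : Finset ι)
    (p : ι → ℝ≥0∞) {F : ι → (∀ i, X i) → ℝ≥0∞} (hF : ∀ i, Measurable (F i)) (x : ∀ i, X i) :
    ∑ i ∈ I, p i * (∫⋯∫⁻_s, F i ∂μ) x = (∫⋯∫⁻_s, (fun x => ∑ i ∈ I, p i * F i x) ∂μ) x := by
  simp only [lmarginal]
  have h : ∀ i, Measurable fun y => F i (Function.updateFinset x s y) := fun i =>
    (hF i).comp measurable_updateFinset
  rw [lintegral_finsetSum _ fun i _ => (h i).const_mul _]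
  exact Finset.sum_congr rfl fun i _ => (lintegral_const_mul _ (h i)).symm

/-! ### The path after time `t`: increments and integration. -/

section Future

variable {T N D : ℕ} {A : AuxModel D} {u : StatePath T D} {t r : ℕ}

/-- The coordinates of the path at the times after `t`. -/
def tail (T t : ℕ) : Finset (Fin T) := Finset.univ.filter fun s => t ≤ s

theorem tail_zero : tail T 0 = Finset.univ := by simp [tail]

theorem tail_self : tail T T = ∅ := by
  simp [tail, Finset.filter_eq_empty_iff]

/-- The index `t` stands for the time `t + 1`, the next state to be integrated. -/
theorem tail_eq_insert (ht : t < T) : tail T t = insert ⟨t, ht⟩ (tail T (t + 1)) := by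
  ext s
  simp only [tail, Finset.mem_filter, Finset.mem_univ, true_and, Finset.mem_insert, Fin.ext_iff]
  omega

theorem notMem_tail (ht : t < T) : (⟨t, ht⟩ : Fin T) ∉ tail T (t + 1) := by
  simp [tail]

theorem coord_updateFinset_tail (x : StatePath T D) {s : ℕ} (hs : s ≤ t)
    (y : ∀ _ : tail T t, State D) : coord (Function.updateFinset x (tail T t) y) s = coord x s := by
  by_cases h : 1 ≤ s ∧ s ≤ T
  · rw [coord_of_mem _ h, coord_of_mem _ h, Function.updateFinset, dif_neg]
    simp only [tail, Finset.mem_filter, Finset.mem_univ, true_and]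
    omega
  · rw [coord_of_not_mem _ h, coord_of_not_mem _ h]

/-- `∏_{s=t+1}^{t+r} Q'_s(x_{s-2:s}; u_{s-1:s})` as a function of `x_{t-1} = a`, `x_t = b` and the
path `x` after time `t`. -/
noncomputable def future (A : AuxModel D) (u : StatePath T D) :
    ℕ → ℕ → State D → State D → StatePath T D → ℝ
  | 0, _, _, _, _ => 1
  | r + 1, t, a, b, x =>
    A.incr (t + 1) a b (coord x (t + 1)) (coord u t) (coord u (t + 1)) *
      future A u r (t + 1) b (coord x (t + 1)) x

theorem future_congr {x y : StatePath T D} : ∀ {r t : ℕ} {a b : State D},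
    (∀ s, t < s → coord x s = coord y s) → future A u r t a b x = future A u r t a b y := by
  intro r
  induction r with
  | zero => intros; rfl
  | succ r ih =>
    intro t a b h
    rw [future, future, h (t + 1) (by omega), ih fun s hs => h s (by omega)]

theorem future_setCoord (x : StatePath T D) (a b y : State D) :
    future A u r t a b (setCoord x t y) = future A u r t a b x :=
  future_congr fun s hs => coord_setCoord_of_ne x (by omega) y

theorem nextGen_congr {x y : StatePath T D} {g : Gen N D} (h : coord x (t + 1) = coord y (t + 1)) :
    nextGen A u x t g = nextGen A u y t g := by
  rw [nextGen, nextGen, h]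

/-- The reference states up to time `t` enter only through the generation, which is already given.
-/
theorem sweep_congr {x y : StatePath T D} : ∀ {r t : ℕ} {g : Gen N D},
    (∀ s, t < s → coord x s = coord y s) → sweep A u x r t g = sweep A u y r t g := by
  intro r
  induction r with
  | zero => intros; rfl
  | succ r ih =>
    intro t g h
    rw [sweep, sweep, nextGen_congr (h (t + 1) (by omega))]
    congr 1
    funext g1
    rw [ih fun s hs => h s (by omega)]

theorem AuxModel.Regular.measurable_future (hA : A.Regular T) :
    ∀ {r t : ℕ}, t + r = T → ∀ {α : Type*} [MeasurableSpace α] {a b : α → State D}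
      {x : α → StatePath T D}, Measurable a → Measurable b → Measurable x →
      Measurable fun c => future A u r t (a c) (b c) (x c) := by
  intro r
  induction r with
  | zero => intros; exact measurable_const
  | succ r ih =>
    intro t htr α _ a b x ha hb hx
    have hc := (measurable_coord (t + 1)).comp hx
    exact (hA.measurable_incr_comp (Finset.mem_Icc.2 ⟨by omega, by omega⟩) ha hb hc measurable_const
      measurable_const).mul (ih (by omega) hb hc hx)

theorem prod_incr_eq_future (x : StatePath T D) : ∀ r t : ℕ,
    ∏ s ∈ Finset.Icc (t + 1) (t + r), A.incr s (coord x (s - 2)) (coord x (s - 1)) (coord x s)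
      (coord u (s - 1)) (coord u s) = future A u r t (coord x (t - 1)) (coord x t) x := by
  intro r
  induction r with
  | zero => intro t; simp [future]
  | succ r ih =>
    intro t
    have h : Finset.Icc (t + 1) (t + (r + 1)) =
        insert (t + 1) (Finset.Icc (t + 1 + 1) (t + 1 + r)) := by
      ext s
      simp only [Finset.mem_Icc, Finset.mem_insert]
      omega
    rw [h, Finset.prod_insert (by simp), ih (t + 1), future]
    rfl

theorem incrProd_eq_future (x : StatePath T D) : A.incrProd x u = future A u T 0 0 0 x := by
  have h := prod_incr_eq_future (A := A) (u := u) x T 0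
  rw [zero_add, zero_add] at h
  -- Truncated subtraction sends both missing times to `0`, where the state is the dummy `0`.
  rw [AuxModel.incrProd, h, coord_of_not_mem _ (by omega)]

/-- Integration over the path after time `t`, the other states being those of `x`. -/
noncomputable def tailIntegral (t : ℕ) (F : StatePath T D → ℝ≥0∞) (x : StatePath T D) : ℝ≥0∞ :=
  (∫⋯∫⁻_tail T t, F ∂fun _ => (volume : Measure (State D))) x

theorem tailIntegral_setCoord (ht : t < T) {F : StatePath T D → ℝ≥0∞} (hF : Measurable F)
    (x : StatePath T D) (y : State D) :
    tailIntegral (t + 1) F (setCoord x (t + 1) y) =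
      tailIntegral (t + 1) (fun x => F (setCoord x (t + 1) y)) x := by
  simp_rw [setCoord_eq_update _ ht]
  exact lmarginal_update_of_notMem hF (notMem_tail ht) x y

/-- The mutation density in the next increment turns Lebesgue measure for `x_{t+1}` into the
mutation law; the potential is left over and will become the weight. -/
theorem AuxModel.Regular.tailIntegral_future_succ (hA : A.Regular T) (ht : t + (r + 1) = T)
    (a b : State D) {E : StatePath T D → ℝ≥0∞} (hE : Measurable E) (x : StatePath T D) :
    tailIntegral t (fun x => ENNReal.ofReal (future A u (r + 1) t a b x) * E x) x =
      ∫⁻ y, ENNReal.ofReal (A.pot (t + 1) a b y (coord u t) (coord u (t + 1))) *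
        tailIntegral (t + 1) (fun x => ENNReal.ofReal (future A u r (t + 1) b y x) * E x)
          (setCoord x (t + 1) y) ∂A.mutation (t + 1) b (coord u (t + 1)) := by
  have htT : t < T := by omega
  have ht1 : t + 1 ∈ Finset.Icc 1 T := Finset.mem_Icc.2 ⟨by omega, by omega⟩
  have hm : Measurable fun y =>
      ENNReal.ofReal (A.mutationDensity (t + 1) b (coord u (t + 1)) y) :=
    measurable_ofReal_gaussianDensity _ _
  have hF : Measurable fun x : StatePath T D =>
      ENNReal.ofReal (future A u (r + 1) t a b x) * E x :=
    (hA.measurable_future ht measurable_const measurable_const measurable_id).ennreal_ofReal.mul hE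
  rw [hA.mutation_eq_withDensity ht1, lintegral_withDensity_eq_lintegral_mul_non_measurable _ hm
    (Filter.Eventually.of_forall fun _ => ENNReal.ofReal_lt_top), tailIntegral, tail_eq_insert htT,
    lmarginal_insert _ hF (notMem_tail htT)]
  refine lintegral_congr fun y => ?_
  rw [← setCoord_eq_update, Pi.mul_apply, ← mul_assoc, ← ENNReal.ofReal_mul
    (hA.mutationDensity_pos ht1 _ _ _).le, tailIntegral, lmarginal, lmarginal,
    ← lintegral_const_mul' _ _ ENNReal.ofReal_ne_top]
  refine lintegral_congr fun z => ?_
  rw [future, coord_updateFinset_tail _ le_rfl, coord_setCoord_self _ (Finset.mem_Icc.1 ht1),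
    ← mul_assoc, ENNReal.ofReal_mul (hA.incr_pos ht1 _ _ _ _ _).le]
  rfl

end Future

/-! ### Invariance of conditional sequential Monte Carlo for fixed auxiliary variables. -/

section Invariance

variable {T N D : ℕ} {A : AuxModel D} {u : StatePath T D} {t r : ℕ}

/-- The rest of the algorithm from time `t` on preserves the joint law of a lineage, selected
according to the weights, and the path after time `t`. -/
def SweepInvariant (N : ℕ) (A : AuxModel D) (u : StatePath T D) (r t : ℕ) : Prop :=
  ∀ (h : Fin (N + 1) → State D × State D × State D) (φ : StatePath T D → ℝ≥0∞), Measurable φ →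
    ∑ k, ENNReal.ofReal (normWeight A u t (k, h) k) *
        tailIntegral t (fun x => ENNReal.ofReal (future A u r t (h k).2.1 (h k).2.2 x) *
          ∫⁻ y, φ y ∂sweep A u x r t (k, h)) 0 =
      ∑ k, ENNReal.ofReal (normWeight A u t (k, h) k) *
        tailIntegral t (fun x => ENNReal.ofReal (future A u r t (h k).2.1 (h k).2.2 x) * φ x)
          (setCoord 0 t (h k).2.2)

/-- One step of the forward pass. The lineages `(a k, b k)` have the masses `p k`; the law `χ` is
that of a generation of independently drawn particles. -/
theorem AuxModel.Regular.sum_tailIntegral_step (hA : A.Regular T) (hN : 1 ≤ N)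
    (htr : t + 1 + r = T) {K : Type*} [Fintype K] (p : K → ℝ≥0∞) (a b : K → State D)
    {ν : K → State D → Measure (Gen N D)} (hν : ∀ k, IsMarkovMap (ν k))
    (χ : Measure (Fin (N + 1) → State D × State D × State D)) [IsProbabilityMeasure χ]
    (hχ : ∀ Θ : State D × State D × State D → Gen N D → ℝ≥0∞, Measurable (Function.uncurry Θ) →
      ∑ k, p k * ∫⁻ y, ∫⁻ g, Θ (a k, b k, y) g ∂ν k y ∂A.mutation (t + 1) (b k) (coord u (t + 1)) =
        ∫⁻ k, ∫⁻ h, Θ (h k) (k, h) ∂χ ∂categorical fun _ : Fin (N + 1) => 1)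
    (hr : SweepInvariant N A u r (t + 1)) {φ : StatePath T D → ℝ≥0∞} (hφ : Measurable φ) :
    ∑ k, p k * tailIntegral t (fun x => ENNReal.ofReal (future A u (r + 1) t (a k) (b k) x) *
        ∫⁻ g, ∫⁻ y, φ y ∂sweep A u x r (t + 1) g ∂ν k (coord x (t + 1))) 0 =
      ∑ k, p k *
        tailIntegral t (fun x => ENNReal.ofReal (future A u (r + 1) t (a k) (b k) x) * φ x) 0 := by
  have ht1 : t + 1 ∈ Finset.Icc 1 T := Finset.mem_Icc.2 ⟨by omega, by omega⟩
  have hfut : ∀ {α : Type} [MeasurableSpace α] {l : α → State D × State D × State D}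
      {x : α → StatePath T D}, Measurable l → Measurable x → Measurable fun c =>
        ENNReal.ofReal (future A u r (t + 1) (l c).2.1 (l c).2.2 (x c)) := fun hl hx =>
    (hA.measurable_future htr hl.snd.fst hl.snd.snd hx).ennreal_ofReal
  have hpot : Measurable fun l : State D × State D × State D =>
      ENNReal.ofReal (A.pot (t + 1) l.1 l.2.1 l.2.2 (coord u t) (coord u (t + 1))) :=
    (hA.measurable_pot_comp ht1 measurable_fst measurable_snd.fst measurable_snd.snd
      measurable_const measurable_const).ennreal_ofReal
  have hsw : Measurable fun q : StatePath T D × Gen N D => ∫⁻ y, φ y ∂sweep A u q.1 r (t + 1) q.2 :=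
    (hA.isMarkovMap_sweep hN (u := fun _ : StatePath T D × Gen N D => u) (by omega) htr
      measurable_const measurable_fst measurable_snd).measurable_lintegral (hφ.comp measurable_snd)
  -- The two sides as functions of the reference lineage `l` and the generation: `Θ₁` runs the rest
  -- of the algorithm, `Θ₂` keeps the reference path.
  let Θ₁ : State D × State D × State D → Gen N D → ℝ≥0∞ := fun l g =>
    ENNReal.ofReal (A.pot (t + 1) l.1 l.2.1 l.2.2 (coord u t) (coord u (t + 1))) *
      tailIntegral (t + 1) (fun x => ENNReal.ofReal (future A u r (t + 1) l.2.1 l.2.2 x) *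
        ∫⁻ y, φ y ∂sweep A u x r (t + 1) g) 0
  let Θ₂ : State D × State D × State D → Gen N D → ℝ≥0∞ := fun l _ =>
    ENNReal.ofReal (A.pot (t + 1) l.1 l.2.1 l.2.2 (coord u t) (coord u (t + 1))) *
      tailIntegral (t + 1) (fun x => ENNReal.ofReal (future A u r (t + 1) l.2.1 l.2.2 x) * φ x)
        (setCoord 0 (t + 1) l.2.2)
  have hΘ₁ : Measurable (Function.uncurry Θ₁) := by
    refine (hpot.comp measurable_fst).mul (measurable_lmarginal_param
      (F := fun (q : (State D × State D × State D) × Gen N D) (x : StatePath T D) =>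
        ENNReal.ofReal (future A u r (t + 1) q.1.2.1 q.1.2.2 x) *
          ∫⁻ y, φ y ∂sweep A u x r (t + 1) q.2) ?_ measurable_const)
    exact (hfut measurable_fst.fst measurable_snd).mul
      (hsw.comp (measurable_snd.prodMk measurable_fst.snd))
  have hΘ₂ : Measurable (Function.uncurry Θ₂) := by
    refine (hpot.comp measurable_fst).mul (measurable_lmarginal_param
      (F := fun (q : (State D × State D × State D) × Gen N D) (x : StatePath T D) =>
        ENNReal.ofReal (future A u r (t + 1) q.1.2.1 q.1.2.2 x) * φ x) ?_
          (measurable_setCoord measurable_const _ measurable_fst.snd.snd))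
    exact (hfut measurable_fst.fst measurable_snd).mul (hφ.comp measurable_snd)
  have hE : ∀ k, Measurable fun x : StatePath T D =>
      ∫⁻ g, ∫⁻ y, φ y ∂sweep A u x r (t + 1) g ∂ν k (coord x (t + 1)) := fun k =>
    ((hν k).comp (measurable_coord (T := T) (t + 1))).measurable_lintegral hsw
  have h1 : ∀ k, tailIntegral t (fun x => ENNReal.ofReal (future A u (r + 1) t (a k) (b k) x) *
        ∫⁻ g, ∫⁻ y, φ y ∂sweep A u x r (t + 1) g ∂ν k (coord x (t + 1))) 0 =
      ∫⁻ y, ∫⁻ g, Θ₁ (a k, b k, y) g ∂ν k y ∂A.mutation (t + 1) (b k) (coord u (t + 1)) := by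
    intro k
    rw [hA.tailIntegral_future_succ (by omega) _ _ (hE k)]
    refine lintegral_congr fun y => ?_
    have := (hν k).2 y
    have hf : Measurable fun x : StatePath T D =>
        ENNReal.ofReal (future A u r (t + 1) (b k) y x) :=
      hfut (l := fun _ => (0, b k, y)) measurable_const measurable_id
    have hfE : Measurable fun x : StatePath T D => ENNReal.ofReal (future A u r (t + 1) (b k) y x) *
        ∫⁻ g, ∫⁻ y, φ y ∂sweep A u x r (t + 1) g ∂ν k (coord x (t + 1)) := hf.mul (hE k)
    rw [tailIntegral_setCoord (by omega) hfE]
    simp only [future_setCoord, coord_setCoord_self _ (Finset.mem_Icc.1 ht1)]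
    have h2 : ∀ x (g : Gen N D), sweep A u (setCoord x (t + 1) y) r (t + 1) g = sweep A u x r (t + 1) g :=
      fun x g => sweep_congr fun s hs => coord_setCoord_of_ne x (by omega) y
    have h3 : ∀ x, ENNReal.ofReal (future A u r (t + 1) (b k) y x) *
        ∫⁻ g, ∫⁻ z, φ z ∂sweep A u x r (t + 1) g ∂ν k y =
        ∫⁻ g, ENNReal.ofReal (future A u r (t + 1) (b k) y x) *
          ∫⁻ z, φ z ∂sweep A u x r (t + 1) g ∂ν k y := fun x =>
      (lintegral_const_mul' _ _ ENNReal.ofReal_ne_top).symm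
    simp_rw [h2, h3]
    refine (congrArg _ ?_).trans (lintegral_const_mul' _ _ ENNReal.ofReal_ne_top).symm
    exact lmarginal_lintegral (μ := fun _ : Fin T => (volume : Measure (State D)))
      (F := fun x g => ENNReal.ofReal (future A u r (t + 1) (b k) y x) *
      ∫⁻ y, φ y ∂sweep A u x r (t + 1) g) ((hf.comp measurable_fst).mul hsw) (ν k y) 0
  -- No generation occurs on this side, so one drawn from the probability measure `ν k y` can be
  -- inserted.
  have h2 : ∀ k, tailIntegral t (fun x => ENNReal.ofReal (future A u (r + 1) t (a k) (b k) x) *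
        φ x) 0 =
      ∫⁻ y, ∫⁻ g, Θ₂ (a k, b k, y) g ∂ν k y ∂A.mutation (t + 1) (b k) (coord u (t + 1)) := by
    intro k
    rw [hA.tailIntegral_future_succ (by omega) _ _ hφ]
    refine lintegral_congr fun y => ?_
    have := (hν k).2 y
    simp [Θ₂]
  have hsw' : ∀ Θ : State D × State D × State D → Gen N D → ℝ≥0∞, Measurable (Function.uncurry Θ) →
      ∫⁻ k, ∫⁻ h, Θ (h k) (k, h) ∂χ ∂(categorical fun _ : Fin (N + 1) => 1) =
        ∫⁻ h, ∑ k, ENNReal.ofReal (1 / ∑ _j : Fin (N + 1), 1) * Θ (h k) (k, h) ∂χ := by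
    intro Θ hΘ
    have hk : ∀ k, Measurable fun h : Fin (N + 1) → State D × State D × State D =>
        Θ (h k) (k, h) := fun k => hΘ.comp (f := fun h : Fin (N + 1) → State D × State D × State D =>
        (h k, k, h)) (by fun_prop)
    rw [lintegral_categorical, lintegral_finsetSum _ fun k _ => (hk k).const_mul _]
    exact Finset.sum_congr rfl fun k _ => (lintegral_const_mul _ (hk k)).symm
  simp_rw [h1, h2]
  rw [hχ Θ₁ hΘ₁, hχ Θ₂ hΘ₂, hsw' Θ₁ hΘ₁, hsw' Θ₂ hΘ₂]
  refine lintegral_congr fun h => ?_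
  rw [← Finset.mul_sum, ← Finset.mul_sum]
  congr 1
  -- The potential of the lineage `k` is its normalised weight times the total weight. The total
  -- does not depend on `k` and factors out, which leaves the hypothesis at time `t + 1`.
  have hw : ∀ k, ENNReal.ofReal (A.pot (t + 1) (h k).1 (h k).2.1 (h k).2.2 (coord u t)
      (coord u (t + 1))) = ENNReal.ofReal (∑ n, weight A u (t + 1) (k, h) n) *
        ENNReal.ofReal (normWeight A u (t + 1) (k, h) k) := by
    intro k
    rw [← ENNReal.ofReal_mul (hA.sum_weight_pos ht1 u _).le, normWeight,
      mul_div_cancel₀ _ (hA.sum_weight_pos ht1 u _).ne']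
    rfl
  have hc : ∀ k, ∑ n, weight A u (t + 1) (k, h) n = ∑ n, weight A u (t + 1) (0, h) n := fun _ => rfl
  simp only [Θ₁, Θ₂, hw, hc, mul_assoc]
  rw [← Finset.mul_sum, ← Finset.mul_sum, hr h φ hφ]

/-- The forced move is a Metropolis–Hastings step for the law `W` whose proposal is `W` conditioned
to leave `k`; the acceptance probability is the corresponding Hastings ratio. -/
theorem sum_lintegral_forcedMove (hN : 1 ≤ N) {W : Fin (N + 1) → ℝ} (h0 : ∀ i, 0 < W i)
    (h1 : ∑ i, W i = 1) (f : Fin (N + 1) → ℝ≥0∞) :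
    ∑ k, ENNReal.ofReal (W k) * ∫⁻ l, f l ∂forcedMove W k = ∑ k, ENNReal.ofReal (W k) * f k := by
  set m : Fin (N + 1) → Fin (N + 1) → ℝ := fun k i => min 1 ((1 - W k) / (1 - W i)) with hm
  have hpos := one_sub_pos_of_sum_eq_one hN h0 h1
  have hI : ∀ k, ENNReal.ofReal (W k) * ∫⁻ l, f l ∂forcedMove W k =
      ∑ i ∈ Finset.univ.erase k,
        (ENNReal.ofReal (W k * (W i / (1 - W k)) * m k i) * f i +
          ENNReal.ofReal (W k) * ENNReal.ofReal (W i / (1 - W k)) * ENNReal.ofReal (1 - m k i) *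
            f k) := by
    intro k
    rw [forcedMove, lintegral_bind_of_measurable Measurable.of_discrete Measurable.of_discrete,
      lintegral_finsetSum_measure, Finset.mul_sum]
    refine Finset.sum_congr rfl fun i _ => ?_
    simp only [lintegral_smul_measure, lintegral_add_measure, lintegral_dirac, smul_eq_mul]
    rw [ENNReal.ofReal_mul (by have := hpos k; have := h0 k; have := h0 i; positivity),
      ENNReal.ofReal_mul (h0 k).le]
    ring
  -- Detailed balance: both sides equal `W k * W i / max (1 - W k) (1 - W i)`.
  have hsymm : ∀ k i, W k * (W i / (1 - W k)) * m k i = W i * (W k / (1 - W i)) * m i k := by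
    intro k i
    have hk := hpos k
    have hi := hpos i
    rcases le_total (1 - W k) (1 - W i) with h | h
    · have e1 : m k i = (1 - W k) / (1 - W i) := min_eq_right ((div_le_one hi).2 h)
      have e2 : m i k = 1 := min_eq_left ((one_le_div hk).2 h)
      rw [e1, e2]
      field_simp
    · have e1 : m i k = (1 - W i) / (1 - W k) := min_eq_right ((div_le_one hk).2 h)
      have e2 : m k i = 1 := min_eq_left ((one_le_div hi).2 h)
      rw [e1, e2]
      field_simp
  simp_rw [hI, Finset.sum_add_distrib]
  have hswap : ∑ k, ∑ i ∈ Finset.univ.erase k, ENNReal.ofReal (W k * (W i / (1 - W k)) * m k i) * f i =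
      ∑ k, ∑ i ∈ Finset.univ.erase k, ENNReal.ofReal (W k * (W i / (1 - W k)) * m k i) * f k := by
    rw [Finset.sum_comm' (t' := Finset.univ) (s' := fun i => Finset.univ.erase i)
      (by intro k i; simp [eq_comm])]
    exact Finset.sum_congr rfl fun k _ => Finset.sum_congr rfl fun i _ => by rw [hsymm]
  rw [hswap, ← Finset.sum_add_distrib]
  refine Finset.sum_congr rfl fun k _ => ?_
  rw [← Finset.sum_add_distrib]
  -- Accepted moves have been reflected onto `f k`, so acceptance and rejection together restore the
  -- full proposal mass.
  calc _ = ∑ i ∈ Finset.univ.erase k, ENNReal.ofReal (W i / (1 - W k)) *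
        (ENNReal.ofReal (W k) * f k) := by
        refine Finset.sum_congr rfl fun i _ => ?_
        rw [ENNReal.ofReal_mul (by have := hpos k; have := h0 k; have := h0 i; positivity),
          ENNReal.ofReal_mul (h0 k).le, ← add_mul, ← mul_add,
          ofReal_min_add_ofReal hN h0 h1 i k, mul_one]
        ring
    _ = _ := by rw [← Finset.sum_mul, sum_erase_ofReal_div hN h0 h1, one_mul]

/-- Given the later states, the conditional law of the index is proportional to its weight times the
future increments, and backward sampling draws from exactly this law: a Gibbs step. -/
theorem AuxModel.Regular.sum_lintegral_backward (hA : A.Regular T) (ht : 1 ≤ t)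
    (htr : t + (r + 1) = T) (h : Fin (N + 1) → State D × State D × State D) (y : StatePath T D)
    (f : Fin (N + 1) → ℝ≥0∞) :
    ∑ k, ENNReal.ofReal (normWeight A u t (k, h) k) *
        (ENNReal.ofReal (future A u (r + 1) t (h k).2.1 (h k).2.2 y) *
          ∫⁻ l, f l ∂backward A u t (0, h) y) =
      ∑ k, ENNReal.ofReal (normWeight A u t (k, h) k) *
        (ENNReal.ofReal (future A u (r + 1) t (h k).2.1 (h k).2.2 y) * f k) := by
  have htm : t ∈ Finset.Icc 1 T := Finset.mem_Icc.2 ⟨ht, by omega⟩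
  have htm1 : t + 1 ∈ Finset.Icc 1 T := Finset.mem_Icc.2 ⟨by omega, by omega⟩
  set v : Fin (N + 1) → ℝ := fun i => normWeight A u t (0, h) i *
      A.incr (t + 1) (h i).2.1 (h i).2.2 (coord y (t + 1)) (coord u t) (coord u (t + 1)) *
      (if t + 2 ≤ T then
        A.incr (t + 2) (h i).2.2 (coord y (t + 1)) (coord y (t + 2))
          (coord u (t + 1)) (coord u (t + 2))
      else 1) with hv
  have hv0 : ∀ i, 0 < v i := by
    intro i
    refine mul_pos (mul_pos (hA.normWeight_pos htm _ _ _) (hA.incr_pos htm1 _ _ _ _ _)) ?_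
    split_ifs with h2
    · exact hA.incr_pos (Finset.mem_Icc.2 ⟨by omega, h2⟩) _ _ _ _ _
    · exact one_pos
  -- The increments after time `t + 2` involve only states in `y`, hence form a constant `c` common
  -- to all lineages. It is `1` when `t + 1 = T`.
  obtain ⟨c, hc⟩ : ∃ c : ℝ, ∀ i,
      normWeight A u t (i, h) i * future A u (r + 1) t (h i).2.1 (h i).2.2 y = v i * c := by
    cases r with
    | zero =>
      refine ⟨1, fun i => ?_⟩
      simp only [hv, future]
      rw [if_neg (by omega), mul_one, mul_one, mul_one]
      rfl
    | succ r =>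
      refine ⟨future A u r (t + 1 + 1) (coord y (t + 1)) (coord y (t + 1 + 1)) y, fun i => ?_⟩
      simp only [hv, future]
      rw [if_pos (by omega), mul_assoc, mul_assoc]
      rfl
  have hV : 0 < ∑ j, v j := Finset.sum_pos (fun i _ => hv0 i) Finset.univ_nonempty
  have hk : ∀ k, ENNReal.ofReal (normWeight A u t (k, h) k) *
      ENNReal.ofReal (future A u (r + 1) t (h k).2.1 (h k).2.2 y) =
        ENNReal.ofReal (v k) * ENNReal.ofReal c := fun k => by
    rw [← ENNReal.ofReal_mul (hA.normWeight_pos htm _ _ _).le, hc, ENNReal.ofReal_mul (hv0 k).le]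
  have hb : backward A u t (0, h) y = categorical v := rfl
  simp_rw [← mul_assoc, hk, hb, lintegral_categorical]
  rw [← Finset.sum_mul, ← Finset.sum_mul, ← ENNReal.ofReal_sum_of_nonneg fun i _ => (hv0 i).le,
    Finset.mul_sum]
  refine Finset.sum_congr rfl fun l _ => ?_
  rw [mul_right_comm, ← mul_assoc, ← ENNReal.ofReal_mul hV.le, mul_div_cancel₀ _ hV.ne',
    mul_right_comm]

theorem AuxModel.Regular.sweepInvariant_zero (hA : A.Regular T) (hN : 1 ≤ N) (hT : 1 ≤ T) :
    SweepInvariant N A u 0 T := by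
  intro h φ hφ
  have htm : T ∈ Finset.Icc 1 T := Finset.mem_Icc.2 ⟨hT, le_rfl⟩
  have hW : ∀ k, normWeight A u T (k, h) k = normWeight A u T (0, h) k := fun _ => rfl
  have hs : ∀ x k, ∫⁻ y, φ y ∂sweep A u x 0 T (k, h) =
      ∫⁻ l, φ (setCoord 0 T (h l).2.2) ∂forcedMove (normWeight A u T ((0, h) : Gen N D)) k := by
    intro x k
    rw [sweep, lintegral_bind_of_measurable Measurable.of_discrete hφ]
    exact lintegral_congr fun l => lintegral_dirac' _ hφ
  simp only [tailIntegral, tail_self, lmarginal_empty, future, ENNReal.ofReal_one, one_mul, hs, hW]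
  exact sum_lintegral_forcedMove (W := normWeight A u T ((0, h) : Gen N D)) hN
    (hA.normWeight_pos htm u _) (hA.sum_normWeight htm u _) fun l => φ (setCoord 0 T (h l).2.2)

/-- The forward step is applied to the test function in which `l_t` has been integrated out, which
settles the path after `t`. For each such path, backward sampling settles the index at time `t`. -/
theorem AuxModel.Regular.sweepInvariant_succ (hA : A.Regular T) (hN : 1 ≤ N) (ht : 1 ≤ t)
    (htT : t + (r + 1) = T) (hr : SweepInvariant N A u r (t + 1)) :
    SweepInvariant N A u (r + 1) t := by
  intro h φ hφ
  have htm : t ∈ Finset.Icc 1 T := Finset.mem_Icc.2 ⟨ht, by omega⟩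
  have htm1 : t + 1 ∈ Finset.Icc 1 T := Finset.mem_Icc.2 ⟨by omega, by omega⟩
  have hφl : ∀ l, Measurable fun y => φ (setCoord y t (h l).2.2) := fun l =>
    hφ.comp (measurable_setCoord measurable_id t measurable_const)
  have hB : IsMarkovMap fun y => backward A u t ((0, h) : Gen N D) y :=
    hA.isMarkovMap_backward htm htm1 measurable_const measurable_id measurable_const
  have hΦ : Measurable fun y => ∫⁻ l, φ (setCoord y t (h l).2.2) ∂backward A u t (0, h) y :=
    hB.measurable_lintegral (measurable_from_prod_countable_left hφl)
  have hBm : IsMarkovMap fun y => (backward A u t ((0, h) : Gen N D) y).bind fun l =>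
      Measure.dirac (setCoord y t (h l).2.2) :=
    hB.bind (isMarkovMap_dirac (measurable_from_prod_countable_left fun l =>
      measurable_setCoord (y := fun _ => (h l).2.2) measurable_id t measurable_const))
  have hs : ∀ x k, ∫⁻ y, φ y ∂sweep A u x (r + 1) t (k, h) =
      ∫⁻ g, ∫⁻ y, ∫⁻ l, φ (setCoord y t (h l).2.2) ∂backward A u t (0, h) y
        ∂sweep A u x r (t + 1) g ∂nextGen A u (setCoord 0 (t + 1) (coord x (t + 1))) t (k, h) := by
    intro x k
    have hS : IsMarkovMap fun g : Gen N D => sweep A u x r (t + 1) g :=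
      hA.isMarkovMap_sweep hN (by omega) (by omega) measurable_const measurable_const measurable_id
    -- The next generation reads a single reference state, so it can be written as a function of
    -- that state alone, as the forward step requires.
    rw [sweep, nextGen_congr (y := x) (coord_setCoord_self _ (Finset.mem_Icc.1 htm1) _)]
    refine (lintegral_bind_of_measurable (hS.bind (hBm.comp measurable_snd)).1 hφ).trans
      (lintegral_congr fun g => ?_)
    refine (lintegral_bind_of_measurable hBm.1 hφ).trans (lintegral_congr fun y => ?_)
    refine (lintegral_bind_of_measurable Measurable.of_discrete hφ).trans
      (lintegral_congr fun l => lintegral_dirac' _ hφ)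
  simp_rw [hs]
  have := hA.isProbabilityMeasure_offspring (u := u) htm h
  rw [hA.sum_tailIntegral_step hN (by omega)
    (fun k => ENNReal.ofReal (normWeight A u t (k, h) k)) (fun k => (h k).2.1)
    (fun k => (h k).2.2) (ν := fun k y => nextGen A u (setCoord 0 (t + 1) y) t (k, h))
    (fun k => hA.isMarkovMap_nextGen htm htm1 measurable_const
      (measurable_setCoord measurable_const _ measurable_id) measurable_const)
    (offspring A u t h) (fun Θ hΘ => hA.lintegral_nextGen_eq_offspring htm htm1 h hΘ)
    hr hΦ]
  have hfm : ∀ k {E : StatePath T D → ℝ≥0∞}, Measurable E → Measurable fun x : StatePath T D =>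
      ENNReal.ofReal (future A u (r + 1) t (h k).2.1 (h k).2.2 x) * E x := fun k _ hE =>
    (hA.measurable_future htT measurable_const measurable_const measurable_id).ennreal_ofReal.mul hE
  have hset : ∀ k, tailIntegral t (fun x =>
      ENNReal.ofReal (future A u (r + 1) t (h k).2.1 (h k).2.2 x) * φ x) (setCoord 0 t (h k).2.2) =
      tailIntegral t (fun x => ENNReal.ofReal (future A u (r + 1) t (h k).2.1 (h k).2.2 x) *
        φ (setCoord x t (h k).2.2)) 0 := by
    intro k
    obtain ⟨s, rfl⟩ : ∃ s, t = s + 1 := ⟨t - 1, by omega⟩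
    rw [tailIntegral_setCoord (by omega) (hfm k hφ)]
    simp only [future_setCoord]
  simp_rw [hset]
  -- The sum over indices is moved inside the integral over the future, so that backward sampling is
  -- treated for each path separately.
  simp only [tailIntegral]
  rw [lmarginal_sum_const_mul _ _ fun k => hfm k hΦ,
    lmarginal_sum_const_mul _ _ fun k => hfm k (hφl k)]
  simp only [hA.sum_lintegral_backward ht htT]

theorem AuxModel.Regular.sweepInvariant (hA : A.Regular T) (hN : 1 ≤ N) :
    ∀ {r t : ℕ}, 1 ≤ t → t + r = T → SweepInvariant N A u r t := by
  intro r
  induction r with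
  | zero =>
    intro t ht htT
    obtain rfl : t = T := by omega
    exact hA.sweepInvariant_zero hN ht
  | succ r ih =>
    intro t ht htT
    exact hA.sweepInvariant_succ hN ht htT (ih (by omega) (by omega))

/-- No integrability in `x` is needed for fixed `u`: this is an identity of unnormalised integrals
in `ℝ≥0∞`. -/
theorem AuxModel.Regular.lintegral_csmc (hA : A.Regular T) (hN : 1 ≤ N) (hT : 1 ≤ T)
    {φ : StatePath T D → ℝ≥0∞} (hφ : Measurable φ) :
    ∫⁻ x, ENNReal.ofReal (A.incrProd x u) * ∫⁻ y, φ y ∂csmc N A u x =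
      ∫⁻ x, ENNReal.ofReal (A.incrProd x u) * φ x := by
  obtain ⟨r, rfl⟩ : ∃ r, T = r + 1 := ⟨T - 1, by omega⟩
  have hs : ∀ x : StatePath (r + 1) D, ∫⁻ y, φ y ∂csmc N A u x =
      ∫⁻ g, ∫⁻ y, φ y ∂sweep A u x r (0 + 1) g ∂firstGen N A u (setCoord 0 1 (coord x (0 + 1))) := by
    intro x
    have hS : IsMarkovMap fun g : Gen N D => sweep A u x r 1 g :=
      hA.isMarkovMap_sweep hN le_rfl (by omega) measurable_const measurable_const measurable_id
    have hf : firstGen N A u (setCoord 0 1 (coord x 1)) = firstGen N A u x := by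
      rw [firstGen, firstGen, coord_setCoord_self _ ⟨le_rfl, hT⟩]
    rw [hf]
    exact lintegral_bind_of_measurable hS.1 hφ
  have hvol : ∀ F : StatePath (r + 1) D → ℝ≥0∞, ∫⁻ x, F x = tailIntegral 0 F 0 := fun F => by
    rw [tailIntegral, tail_zero, lmarginal_univ]
    rfl
  simp_rw [hs, hvol, incrProd_eq_future]
  have := isProbabilityMeasure_initialLineages (N := N) (A := A) (u := u)
  -- The first generation is treated as a step from time `0`, with a single fictitious lineage of
  -- mass one and dummy states `0`.
  have h := hA.sum_tailIntegral_step hN (t := 0) (r := r) (by omega) (K := Unit) (fun _ => 1)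
    (fun _ => 0) (fun _ => 0) (ν := fun _ y => firstGen N A u (setCoord 0 1 y))
    (fun _ => hA.isMarkovMap_firstGen hT measurable_const
      (measurable_setCoord measurable_const _ measurable_id))
    (initialLineages N A u) (fun Θ hΘ => by
      simpa using lintegral_firstGen_eq_initialLineages (A := A) (u := u) hT hΘ)
    (hA.sweepInvariant hN le_rfl (by omega)) hφ
  simpa using h

end Invariance

theorem Fin.prod_univ_succ_eq_prod_Icc {M : Type*} [CommMonoid M] (g : ℕ → M) (T : ℕ) :
    ∏ s : Fin T, g (s + 1) = ∏ t ∈ Finset.Icc 1 T, g t := by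
  rw [Fin.prod_univ_eq_prod_range (fun s => g (s + 1)), Finset.range_eq_Ico,
    Finset.prod_Ico_add' g 0 T 1]
  rfl

/-- `c` stands for the Gaussian factors with the filter gradient, `d` for those with the smoothing
gradient. The ratio at time `t` replaces `c (t - 1)` by `d (t - 1)`, so only the last `c` survives.
-/
theorem prod_mul_ratio_eq {c d : ℕ → ℝ} : ∀ {T : ℕ}, (∀ t ∈ Finset.Icc 1 T, c t ≠ 0) →
    ∏ t ∈ Finset.Icc 1 T, c t * (if 2 ≤ t then d (t - 1) / c (t - 1) else 1) =
      ∏ t ∈ Finset.Icc 1 T, if t + 1 ≤ T then d t else c t := by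
  have key : ∀ n : ℕ, (∀ t ∈ Finset.Icc 1 (n + 1), c t ≠ 0) →
      ∏ t ∈ Finset.Icc 1 (n + 1), c t * (if 2 ≤ t then d (t - 1) / c (t - 1) else 1) =
        (∏ t ∈ Finset.Icc 1 n, d t) * c (n + 1) := by
    intro n
    induction n with
    | zero => intro; simp
    | succ n ih =>
      intro hc
      have h1 : c (n + 1) ≠ 0 := hc _ (Finset.mem_Icc.2 ⟨by omega, by omega⟩)
      rw [Finset.prod_Icc_succ_top (by omega), ih fun t ht => hc t
        (Finset.Icc_subset_Icc_right (by omega) ht), if_pos (by omega),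
        Finset.prod_Icc_succ_top (a := 1) (b := n) (by omega)]
      simp only [Nat.add_sub_cancel]
      field_simp
  intro T hc
  cases T with
  | zero => simp
  | succ n =>
    rw [key n hc, Finset.prod_Icc_succ_top (by omega), if_neg (by omega)]
    congr 1
    refine Finset.prod_congr rfl fun t ht => ?_
    rw [if_pos]
    have := (Finset.mem_Icc.1 ht).2
    omega

/-! ### Gradients of the log-densities. -/

section Gradients

variable {T D : ℕ} {f : ℕ → State D → State D → ℝ} {t : ℕ}

theorem differentiable_log_uncurry (h0 : ∀ a b, 0 < f t a b)
    (hf : Differentiable ℝ fun p : State D × State D => f t p.1 p.2) :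
    Differentiable ℝ fun p : State D × State D => Real.log (f t p.1 p.2) :=
  hf.log fun p => (h0 p.1 p.2).ne'

/-- The partial gradient is a continuous function of the total derivative, and derivatives are
measurable without being continuous; differentiability is therefore enough. -/
theorem measurable_gradCur (h0 : ∀ a b, 0 < f t a b)
    (hf : Differentiable ℝ fun p : State D × State D => f t p.1 p.2) {α : Type*}
    [MeasurableSpace α] {a b : α → State D} (ha : Measurable a) (hb : Measurable b) :
    Measurable fun c => gradCur f t (a c) (b c) := by
  have hL := differentiable_log_uncurry h0 hf
  have h : ∀ a b : State D, gradCur f t a b = (InnerProductSpace.toDual ℝ (State D)).symm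
      ((fderiv ℝ (fun p : State D × State D => Real.log (f t p.1 p.2)) (a, b)).comp
        (ContinuousLinearMap.inr ℝ (State D) (State D))) := by
    intro a b
    have h1 : HasFDerivAt (fun y : State D => (a, y)) (ContinuousLinearMap.inr ℝ (State D) (State D)) b :=
      hasFDerivAt_prodMk_right a b
    rw [gradCur, gradient, ← ((hL (a, b)).hasFDerivAt.comp b h1).fderiv]
    rfl
  have hc : Continuous fun φ : State D × State D →L[ℝ] ℝ =>
      (InnerProductSpace.toDual ℝ (State D)).symm
        (φ.comp (ContinuousLinearMap.inr ℝ (State D) (State D))) :=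
    (LinearIsometryEquiv.continuous _).comp (continuous_id.clm_comp continuous_const)
  simp_rw [h]
  exact hc.measurable.comp ((measurable_fderiv ℝ _).comp (ha.prodMk hb))

theorem measurable_gradPrev (h0 : ∀ a b, 0 < f t a b)
    (hf : Differentiable ℝ fun p : State D × State D => f t p.1 p.2) {α : Type*}
    [MeasurableSpace α] {a b : α → State D} (ha : Measurable a) (hb : Measurable b) :
    Measurable fun c => gradPrev f t (a c) (b c) := by
  have hL := differentiable_log_uncurry h0 hf
  have h : ∀ a b : State D, gradPrev f t a b = (InnerProductSpace.toDual ℝ (State D)).symm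
      ((fderiv ℝ (fun p : State D × State D => Real.log (f t p.1 p.2)) (a, b)).comp
        (ContinuousLinearMap.inl ℝ (State D) (State D))) := by
    intro a b
    have h1 : HasFDerivAt (fun y : State D => (y, b)) (ContinuousLinearMap.inl ℝ (State D) (State D)) a :=
      hasFDerivAt_prodMk_left a b
    rw [gradPrev, gradient, ← ((hL (a, b)).hasFDerivAt.comp a h1).fderiv]
    rfl
  have hc : Continuous fun φ : State D × State D →L[ℝ] ℝ =>
      (InnerProductSpace.toDual ℝ (State D)).symm
        (φ.comp (ContinuousLinearMap.inl ℝ (State D) (State D))) :=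
    (LinearIsometryEquiv.continuous _).comp (continuous_id.clm_comp continuous_const)
  simp_rw [h]
  exact hc.measurable.comp ((measurable_fderiv ℝ _).comp (ha.prodMk hb))

theorem hasGradientAt_log_pathProd (h0 : ∀ t ∈ Finset.Icc 1 T, ∀ a b, 0 < f t a b)
    (hf : ∀ t ∈ Finset.Icc 1 T, Differentiable ℝ fun p : State D × State D => f t p.1 p.2)
    (ht : t ∈ Finset.Icc 1 T) (x : StatePath T D) :
    HasGradientAt (fun y => Real.log (pathProd f T (setCoord x t y)))
      (gradCur f t (coord x (t - 1)) (coord x t) +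
        if t + 1 ≤ T then gradPrev f (t + 1) (coord x t) (coord x (t + 1)) else 0) (coord x t) := by
  have hlog : (fun y => Real.log (pathProd f T (setCoord x t y))) = fun y =>
      ∑ s ∈ Finset.Icc 1 T,
        Real.log (f s (coord (setCoord x t y) (s - 1)) (coord (setCoord x t y) s)) := by
    funext y
    exact Real.log_prod fun s hs => (h0 s hs _ _).ne'
  -- The state at time `t` appears as current argument of the factor `t` and as previous argument of
  -- the factor `t + 1`, and nowhere else.
  have hterm : ∀ s ∈ Finset.Icc 1 T, HasGradientAt
      (fun y => Real.log (f s (coord (setCoord x t y) (s - 1)) (coord (setCoord x t y) s)))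
      ((if s = t then gradCur f t (coord x (t - 1)) (coord x t) else 0) +
        if s = t + 1 then gradPrev f (t + 1) (coord x t) (coord x (t + 1)) else 0) (coord x t) := by
    intro s hs
    have ht' := Finset.mem_Icc.1 ht
    have hs' := Finset.mem_Icc.1 hs
    have hL := differentiable_log_uncurry (h0 s hs) (hf s hs)
    by_cases h1 : s = t
    · subst h1
      simp_rw [coord_setCoord_of_ne x (show s - 1 ≠ s by omega), coord_setCoord_self x ht']
      rw [if_pos trivial, if_neg (by omega), add_zero]
      exact ((hL _).comp (coord x s) (f := fun y => (coord x (s - 1), y))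
        (by fun_prop)).hasGradientAt
    · by_cases h2 : s = t + 1
      · subst h2
        simp_rw [coord_setCoord_of_ne x (show t + 1 ≠ t by omega), Nat.add_sub_cancel,
          coord_setCoord_self x ht']
        rw [if_neg h1, if_pos trivial, zero_add]
        exact ((hL _).comp (coord x t) (f := fun y => (y, coord x (t + 1)))
          (by fun_prop)).hasGradientAt
      · simp_rw [coord_setCoord_of_ne x (show s - 1 ≠ t by omega), coord_setCoord_of_ne x h1]
        rw [if_neg h1, if_neg h2, add_zero]
        exact hasGradientAt_const _ _
  have hsum := HasFDerivAt.fun_sum fun s hs => (hterm s hs).hasFDerivAt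
  -- Membership of `t + 1` in the range of the sum produces the condition `t + 1 ≤ T` of the
  -- statement.
  rw [← map_sum, Finset.sum_add_distrib, Finset.sum_ite_eq' , Finset.sum_ite_eq', if_pos ht] at hsum
  rw [hlog, hasGradientAt_iff_hasFDerivAt]
  simpa only [Finset.mem_Icc, le_add_iff_nonneg_left, zero_le, true_and] using hsum

theorem blockGrad_logPotential (h0 : ∀ t ∈ Finset.Icc 1 T, ∀ a b, 0 < f t a b)
    (hf : ∀ t ∈ Finset.Icc 1 T, Differentiable ℝ fun p : State D × State D => f t p.1 p.2)
    (ht : t ∈ Finset.Icc 1 T) (x : StatePath T D) :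
    blockGrad (logPotential f T) t x = gradCur f t (coord x (t - 1)) (coord x t) +
      if t + 1 ≤ T then gradPrev f (t + 1) (coord x t) (coord x (t + 1)) else 0 :=
  (hasGradientAt_log_pathProd h0 hf ht x).gradient

theorem pathProd_pos (h0 : ∀ t ∈ Finset.Icc 1 T, ∀ a b, 0 < f t a b) (x : StatePath T D) :
    0 < pathProd f T x :=
  Finset.prod_pos fun s hs => h0 s hs _ _

theorem integral_pathProd_pos (h0 : ∀ t ∈ Finset.Icc 1 T, ∀ a b, 0 < f t a b)
    (hi : Integrable (pathProd f T)) : 0 < ∫ y : StatePath T D, pathProd f T y := by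
  rw [integral_pos_iff_support_of_nonneg (fun x => (pathProd_pos h0 x).le) hi]
  have : Function.support (pathProd f T) = Set.univ :=
    Set.eq_univ_of_forall fun x => (pathProd_pos h0 x).ne'
  rw [this]
  exact isOpen_univ.measure_pos _ Set.univ_nonempty

/-- The normalising constant, positive by integrability and positivity of the factors, is an
additive constant in the logarithm. -/
theorem blockGrad_logSmoothing (h0 : ∀ t ∈ Finset.Icc 1 T, ∀ a b, 0 < f t a b)
    (hf : ∀ t ∈ Finset.Icc 1 T, Differentiable ℝ fun p : State D × State D => f t p.1 p.2)
    (hi : Integrable (pathProd f T)) (ht : t ∈ Finset.Icc 1 T) (x : StatePath T D) :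
    blockGrad (logSmoothing f T) t x = gradCur f t (coord x (t - 1)) (coord x t) +
      if t + 1 ≤ T then gradPrev f (t + 1) (coord x t) (coord x (t + 1)) else 0 := by
  have h : ∀ x, logSmoothing f T x =
      Real.log (pathProd f T x) - Real.log (∫ y : StatePath T D, pathProd f T y) := fun x =>
    Real.log_div (pathProd_pos h0 x).ne' (integral_pathProd_pos h0 hi).ne'
  have hg := (hasGradientAt_log_pathProd h0 hf ht x).hasFDerivAt.sub_const
    (Real.log (∫ y : StatePath T D, pathProd f T y))
  rw [blockGrad]
  simp_rw [h]
  exact (hasGradientAt_iff_hasFDerivAt.2 hg).gradient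

theorem measurable_pathProd
    (hf : ∀ t ∈ Finset.Icc 1 T, Measurable fun p : State D × State D => f t p.1 p.2) :
    Measurable (pathProd f T) :=
  Finset.measurable_prod _ fun s hs =>
    (hf s hs).comp ((measurable_coord (s - 1)).prodMk (measurable_coord s))

end Gradients

/-! ### The auxiliary variables and the Gibbs argument. -/

section AuxiliaryVariables

variable {T N D : ℕ} {F : StatePath T D → ℝ} {κ : ℝ} {δ : ℕ → ℝ}

theorem posDef_halfId (D : ℕ) {δ : ℝ} (hδ : 0 < δ) : (halfId D δ).PosDef :=
  Matrix.PosDef.one.smul (by positivity)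

theorem measurable_auxMean (hF : ∀ t ∈ Finset.Icc 1 T, Measurable (blockGrad F t)) {t : ℕ}
    (ht : t ∈ Finset.Icc 1 T) : Measurable fun x => auxMean F κ δ x t :=
  (measurable_coord t).add ((hF t ht).const_smul (κ * (δ t / 2)))

theorem isMarkovMap_auxLaw (hF : ∀ t ∈ Finset.Icc 1 T, Measurable (blockGrad F t))
    (hδ : ∀ t ∈ Finset.Icc 1 T, 0 < δ t) : IsMarkovMap fun x => auxLaw F κ δ x := by
  refine IsMarkovMap.pi fun s => ?_
  have hs : (s : ℕ) + 1 ∈ Finset.Icc 1 T := Finset.mem_Icc.2 ⟨by omega, by omega⟩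
  exact isMarkovMap_multivariateGaussian (measurable_auxMean hF hs) (fun _ _ => measurable_const)
    fun _ => posDef_halfId D (hδ _ hs)

theorem measurable_auxDensity (hF : ∀ t ∈ Finset.Icc 1 T, Measurable (blockGrad F t)) :
    Measurable fun p : StatePath T D × StatePath T D => auxDensity F κ δ p.1 p.2 :=
  Finset.measurable_prod _ fun t ht =>
    measurable_gaussianDensity ((measurable_auxMean hF ht).comp measurable_fst)
      (fun _ _ => measurable_const) ((measurable_coord t).comp measurable_snd)

theorem auxLaw_eq_withDensity (hδ : ∀ t ∈ Finset.Icc 1 T, 0 < δ t) (x : StatePath T D) :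
    auxLaw F κ δ x = volume.withDensity fun u => ENNReal.ofReal (auxDensity F κ δ x u) := by
  have hs : ∀ s : Fin T, (halfId D (δ (s + 1))).PosDef := fun s =>
    posDef_halfId D (hδ _ (Finset.mem_Icc.2 ⟨by omega, by omega⟩))
  have h : ∀ s : Fin T, multivariateGaussian (auxMean F κ δ x (s + 1)) (halfId D (δ (s + 1))) =
      volume.withDensity fun y => ENNReal.ofReal
        (gaussianDensity (auxMean F κ δ x (s + 1)) (halfId D (δ (s + 1))) y) := fun s =>
    multivariateGaussian_eq_withDensity _ (hs s)
  have : ∀ s : Fin T, SigmaFinite ((volume : Measure (State D)).withDensity fun y => ENNReal.ofReal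
      (gaussianDensity (auxMean F κ δ x (s + 1)) (halfId D (δ (s + 1))) y)) := fun s =>
    h s ▸ inferInstance
  rw [auxLaw]
  simp_rw [h]
  rw [pi_withDensity (μ := fun _ : Fin T => (volume : Measure (State D)))
    fun s => measurable_ofReal_gaussianDensity _ _]
  refine congrArg _ (funext fun u => ?_)
  rw [← ENNReal.ofReal_prod_of_nonneg fun s _ => (gaussianDensity_pos _ (hs s) _).le, auxDensity,
    ← Fin.prod_univ_succ_eq_prod_Icc (fun t =>
      gaussianDensity (auxMean F κ δ x t) (halfId D (δ t)) (coord u t))]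
  congr 1
  refine Finset.prod_congr rfl fun s _ => ?_
  rw [coord_of_mem u ⟨by omega, by omega⟩]
  rfl

/-- Tonelli: with `u` integrated last, the move of `x` can be analysed for each fixed `u`. -/
theorem lintegral_auxLaw_withDensity (hF : ∀ t ∈ Finset.Icc 1 T, Measurable (blockGrad F t))
    (hδ : ∀ t ∈ Finset.Icc 1 T, 0 < δ t) {p : StatePath T D → ℝ} (hp : Measurable p)
    (hp0 : ∀ x, 0 ≤ p x) {E : StatePath T D → StatePath T D → ℝ≥0∞}
    (hE : Measurable (Function.uncurry E)) :
    ∫⁻ x, ∫⁻ u, E x u ∂auxLaw F κ δ x ∂volume.withDensity (fun x => ENNReal.ofReal (p x)) =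
      ∫⁻ u, ∫⁻ x, ENNReal.ofReal (p x * auxDensity F κ δ x u) * E x u := by
  have hp' : Measurable fun x => ENNReal.ofReal (p x) := hp.ennreal_ofReal
  have hd := (measurable_auxDensity (κ := κ) (δ := δ) hF)
  have hm : Measurable fun q : StatePath T D × StatePath T D =>
      ENNReal.ofReal (p q.1 * auxDensity F κ δ q.1 q.2) * E q.1 q.2 :=
    ((hp.comp measurable_fst).mul hd).ennreal_ofReal.mul hE
  rw [lintegral_withDensity_eq_lintegral_mul_non_measurable _ hp'
    (Filter.Eventually.of_forall fun _ => ENNReal.ofReal_lt_top), ← lintegral_lintegral_swap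
    hm.aemeasurable]
  refine lintegral_congr fun x => ?_
  have hdx : Measurable fun u => ENNReal.ofReal (auxDensity F κ δ x u) :=
    (hd.comp (measurable_const.prodMk measurable_id)).ennreal_ofReal
  rw [Pi.mul_apply, auxLaw_eq_withDensity hδ,
    lintegral_withDensity_eq_lintegral_mul_non_measurable _ hdx
      (Filter.Eventually.of_forall fun _ => ENNReal.ofReal_lt_top),
    ← lintegral_const_mul' _ _ ENNReal.ofReal_ne_top]
  refine lintegral_congr fun u => ?_
  rw [Pi.mul_apply, ENNReal.ofReal_mul (hp0 x), mul_assoc]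

/-- Drawing the auxiliary variables and running the conditional sequential Monte Carlo algorithm
leaves a density invariant if the joint density of the path and the auxiliary variables is
proportional to the product of the increments of the auxiliary model. -/
theorem AuxModel.Regular.exists_invariant_kernel {A : AuxModel D} (hA : A.Regular T) (hN : 1 ≤ N)
    (hT : 1 ≤ T) (hF : ∀ t ∈ Finset.Icc 1 T, Measurable (blockGrad F t))
    (hδ : ∀ t ∈ Finset.Icc 1 T, 0 < δ t) {p : StatePath T D → ℝ} (hp : Measurable p)
    (hp0 : ∀ x, 0 ≤ p x) {Z : ℝ} (hZ : 0 < Z)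
    (h : ∀ x u, p x * auxDensity F κ δ x u = A.incrProd x u / Z) :
    ∃ P : Kernel (StatePath T D) (StatePath T D),
      (∀ x, P x = (auxLaw F κ δ x).bind fun u => csmc N A u x) ∧
        IsMarkovKernel P ∧ P.Invariant (volume.withDensity fun x => ENNReal.ofReal (p x)) := by
  have haux := isMarkovMap_auxLaw (κ := κ) hF hδ
  have hcsmc : IsMarkovMap fun q : StatePath T D × StatePath T D => csmc N A q.2 q.1 :=
    hA.isMarkovMap_csmc hN hT measurable_snd measurable_fst
  have hP : IsMarkovMap fun x => (auxLaw F κ δ x).bind fun u => csmc N A u x := haux.bind hcsmc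
  refine ⟨⟨_, hP.1⟩, fun _ => rfl, ⟨hP.2⟩, ?_⟩
  have hjoint : ∀ u (φ : StatePath T D → ℝ≥0∞),
      ∫⁻ x, ENNReal.ofReal (p x * auxDensity F κ δ x u) * φ x =
        ENNReal.ofReal Z⁻¹ * ∫⁻ x, ENNReal.ofReal (A.incrProd x u) * φ x := fun u φ => by
    rw [← lintegral_const_mul' _ _ ENNReal.ofReal_ne_top]
    refine lintegral_congr fun x => ?_
    rw [h, div_eq_inv_mul, ENNReal.ofReal_mul (inv_nonneg.2 hZ.le), mul_assoc]
  refine Measure.ext fun s hs => ?_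
  have hφ : Measurable (s.indicator (1 : StatePath T D → ℝ≥0∞)) := measurable_one.indicator hs
  rw [← lintegral_indicator_one hs, ← lintegral_indicator_one hs,
    lintegral_bind_of_measurable (Kernel.measurable _) hφ]
  have h1 : ∀ x, ∫⁻ y, s.indicator 1 y ∂(auxLaw F κ δ x).bind (fun u => csmc N A u x) =
      ∫⁻ u, ∫⁻ y, s.indicator 1 y ∂csmc N A u x ∂auxLaw F κ δ x := fun x =>
    lintegral_bind_of_measurable (hcsmc.1.comp (measurable_const.prodMk measurable_id)) hφ
  -- Auxiliary variables are inserted on the target side too, so that both sides become integrals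
  -- against the joint density.
  have h2 : ∀ x, s.indicator (1 : StatePath T D → ℝ≥0∞) x =
      ∫⁻ _u, s.indicator 1 x ∂auxLaw F κ δ x := fun x => by
    have := haux.2 x
    simp
  calc _ = ∫⁻ x, ∫⁻ u, ∫⁻ y, s.indicator 1 y ∂csmc N A u x ∂auxLaw F κ δ x
        ∂volume.withDensity (fun x => ENNReal.ofReal (p x)) := lintegral_congr h1
    _ = ∫⁻ x, ∫⁻ _u, s.indicator 1 x ∂auxLaw F κ δ x
        ∂volume.withDensity (fun x => ENNReal.ofReal (p x)) := by
      have hE : Measurable (Function.uncurry fun x u =>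
          ∫⁻ y, s.indicator (1 : StatePath T D → ℝ≥0∞) y ∂csmc N A u x) :=
        hcsmc.measurable_lintegral (hφ.comp measurable_snd)
      have hE' : Measurable (Function.uncurry fun (x _u : StatePath T D) =>
          s.indicator (1 : StatePath T D → ℝ≥0∞) x) := hφ.comp measurable_fst
      rw [lintegral_auxLaw_withDensity hF hδ hp hp0 hE, lintegral_auxLaw_withDensity hF hδ hp hp0 hE']
      refine lintegral_congr fun u => ?_
      rw [hjoint, hjoint, hA.lintegral_csmc hN hT hφ]
    _ = _ := (lintegral_congr h2).symm

end AuxiliaryVariables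

/-! ### The joint density as a product of second-order increments. -/

section Identity

variable {T D : ℕ} {κ : ℝ} {δ : ℕ → ℝ}

/-- For Particle-aMALA+, this lets the mutation density of `x_t` around `u_t` cancel the density of
`u_t` around `x_t` in the potential. -/
theorem gaussianDensity_comm (m x : State D) (S : Matrix (Fin D) (Fin D) ℝ) :
    gaussianDensity m S x = gaussianDensity x S m := by
  have h : (x - m).ofLp = -(m - x).ofLp := by simp
  rw [gaussianDensity, gaussianDensity, h, Matrix.mulVec_neg, neg_dotProduct_neg]

theorem measurable_gaussianDensity_drift {α : Type*} [MeasurableSpace α] {x g u : α → State D}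
    (hx : Measurable x) (hg : Measurable g) (hu : Measurable u) (c δ : ℝ) :
    Measurable fun a => gaussianDensity (x a + c • g a) (halfId D δ) (u a) := by
  have h : Measurable fun a => x a + c • g a := by fun_prop
  exact measurable_gaussianDensity h (S := fun _ => halfId D δ) (fun _ _ => measurable_const) hu

theorem smoothingRatio_pos (f : ℕ → State D → State D → ℝ) (hδ : ∀ t ∈ Finset.Icc 1 T, 0 < δ t)
    {t : ℕ} (ht : t ∈ Finset.Icc 1 T) (x2 x1 x0 u1 : State D) :
    0 < smoothingRatio f κ δ t x2 x1 x0 u1 := by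
  have ht' := Finset.mem_Icc.1 ht
  unfold smoothingRatio
  split_ifs with h
  · have hS := posDef_halfId D (hδ (t - 1) (Finset.mem_Icc.2 ⟨by omega, by omega⟩))
    exact div_pos (gaussianDensity_pos _ hS _) (gaussianDensity_pos _ hS _)
  · exact one_pos

theorem measurable_smoothingRatio {f : ℕ → State D → State D → ℝ}
    (h0 : ∀ t ∈ Finset.Icc 1 T, ∀ a b, 0 < f t a b)
    (hf : ∀ t ∈ Finset.Icc 1 T, Differentiable ℝ fun p : State D × State D => f t p.1 p.2)
    {t : ℕ} (ht : t ∈ Finset.Icc 1 T) {α : Type*} [MeasurableSpace α] {x2 x1 x0 u1 : α → State D}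
    (h2 : Measurable x2) (h1 : Measurable x1) (hx : Measurable x0) (hu : Measurable u1) :
    Measurable fun a => smoothingRatio f κ δ t (x2 a) (x1 a) (x0 a) (u1 a) := by
  have ht' := Finset.mem_Icc.1 ht
  unfold smoothingRatio
  split_ifs with h
  · have hs : t - 1 ∈ Finset.Icc 1 T := Finset.mem_Icc.2 ⟨by omega, by omega⟩
    have hc := measurable_gradCur (h0 _ hs) (hf _ hs) h2 h1
    have hp := measurable_gradPrev (h0 _ ht) (hf _ ht) h1 hx
    exact (measurable_gaussianDensity_drift h1 (hc.add hp) hu (κ * (δ (t - 1) / 2)) (δ (t - 1))).div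
      (measurable_gaussianDensity_drift h1 hc hu (κ * (δ (t - 1) / 2)) (δ (t - 1)))
  · exact measurable_const

/-- The products of the filter corrections and of their smoothing ratios multiply up to the density
of the auxiliary variables. -/
theorem prod_gaussianDensity_mul_smoothingRatio {F : StatePath T D → ℝ}
    (f : ℕ → State D → State D → ℝ) (hδ : ∀ t ∈ Finset.Icc 1 T, 0 < δ t) (x u : StatePath T D)
    (hF : ∀ t ∈ Finset.Icc 1 T, blockGrad F t x = gradCur f t (coord x (t - 1)) (coord x t) +
      if t + 1 ≤ T then gradPrev f (t + 1) (coord x t) (coord x (t + 1)) else 0) :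
    ∏ t ∈ Finset.Icc 1 T,
      gaussianDensity (coord x t + (κ * (δ t / 2)) • gradCur f t (coord x (t - 1)) (coord x t))
        (halfId D (δ t)) (coord u t) *
      smoothingRatio f κ δ t (coord x (t - 2)) (coord x (t - 1)) (coord x t) (coord u (t - 1)) =
    auxDensity F κ δ x u := by
  have h := prod_mul_ratio_eq (T := T) (c := fun t =>
      gaussianDensity (coord x t + (κ * (δ t / 2)) • gradCur f t (coord x (t - 1)) (coord x t))
        (halfId D (δ t)) (coord u t))
    (d := fun t => gaussianDensity (coord x t + (κ * (δ t / 2)) •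
      (gradCur f t (coord x (t - 1)) (coord x t) +
        gradPrev f (t + 1) (coord x t) (coord x (t + 1)))) (halfId D (δ t)) (coord u t))
    fun t ht => (gaussianDensity_pos _ (posDef_halfId D (hδ t ht)) _).ne'
  refine Eq.trans (Finset.prod_congr rfl fun t ht => ?_) (h.trans (Finset.prod_congr rfl fun t ht => ?_))
  · congr 1
    unfold smoothingRatio
    refine if_congr Iff.rfl ?_ rfl
    -- Once `t = s + 1`, the truncated differences `t - 1`, `t - 1 + 1` and `t - 2` agree by
    -- definition with `s`, `s + 1` and `s - 1`.
    obtain ⟨s, rfl⟩ : ∃ s, t = s + 1 := ⟨t - 1, by have := (Finset.mem_Icc.1 ht).1; omega⟩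
    rfl
  · rw [auxMean, hF t ht]
    split_ifs
    · rfl
    · rw [add_zero]

/-- The joint density of the path and the auxiliary variables, if the increments of the auxiliary
model are those of the target times the filter corrections and the smoothing ratios. -/
theorem smoothingDensity_mul_auxDensity {Q f : ℕ → State D → State D → ℝ} {F : StatePath T D → ℝ}
    {A : AuxModel D} (hδ : ∀ t ∈ Finset.Icc 1 T, 0 < δ t) (x u : StatePath T D)
    (hF : ∀ t ∈ Finset.Icc 1 T, blockGrad F t x = gradCur f t (coord x (t - 1)) (coord x t) +
      if t + 1 ≤ T then gradPrev f (t + 1) (coord x t) (coord x (t + 1)) else 0)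
    (hA : ∀ t ∈ Finset.Icc 1 T, ∀ x2 x1 x0 u1 u0, A.incr t x2 x1 x0 u1 u0 = Q t x1 x0 *
      (gaussianDensity (x0 + (κ * (δ t / 2)) • gradCur f t x1 x0) (halfId D (δ t)) u0 *
        smoothingRatio f κ δ t x2 x1 x0 u1)) :
    smoothingDensity Q T x * auxDensity F κ δ x u =
      A.incrProd x u / ∫ y : StatePath T D, pathProd Q T y := by
  rw [smoothingDensity, div_mul_eq_mul_div, ← prod_gaussianDensity_mul_smoothingRatio f hδ x u hF,
    pathProd, ← Finset.prod_mul_distrib, AuxModel.incrProd]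
  congr 1
  exact Finset.prod_congr rfl fun t ht => (hA t ht _ _ _ _ _).symm

end Identity

/-! ### The two auxiliary models. -/

section Models

variable {T N D : ℕ} {κ : ℝ} {δ : ℕ → ℝ}

theorem incr_amalaPlusModel (Q : ℕ → State D → State D → ℝ) {t : ℕ} (hδ : 0 < δ t)
    (x2 x1 x0 u1 u0 : State D) : (amalaPlusModel Q κ δ).incr t x2 x1 x0 u1 u0 = Q t x1 x0 *
      (gaussianDensity (x0 + (κ * (δ t / 2)) • gradCur Q t x1 x0) (halfId D (δ t)) u0 *
        smoothingRatio Q κ δ t x2 x1 x0 u1) := by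
  have h := (gaussianDensity_pos x0 (posDef_halfId D hδ) u0).ne'
  simp only [AuxModel.incr, AuxModel.mutationDensity, amalaPlusModel]
  rw [gaussianDensity_comm u0]
  field_simp

theorem regular_amalaPlusModel {Q : ℕ → State D → State D → ℝ}
    (h0 : ∀ t ∈ Finset.Icc 1 T, ∀ a b, 0 < Q t a b)
    (hQ : ∀ t ∈ Finset.Icc 1 T, Differentiable ℝ fun p : State D × State D => Q t p.1 p.2)
    (hδ : ∀ t ∈ Finset.Icc 1 T, 0 < δ t) : (amalaPlusModel Q κ δ).Regular T where
  measurable_mean _ _ := measurable_snd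
  measurable_cov _ _ _ _ := measurable_const
  posDef_cov t ht _ := posDef_halfId D (hδ t ht)
  measurable_pot t ht := by
    have hx1 : Measurable fun p : State D × State D × State D × State D × State D => p.2.1 := by
      fun_prop
    have hx0 : Measurable fun p : State D × State D × State D × State D × State D => p.2.2.1 := by
      fun_prop
    have hu1 : Measurable fun p : State D × State D × State D × State D × State D => p.2.2.2.1 := by
      fun_prop
    have hu0 : Measurable fun p : State D × State D × State D × State D × State D => p.2.2.2.2 := by
      fun_prop
    have hQm : Measurable fun p : State D × State D × State D × State D × State D =>
        Q t p.2.1 p.2.2.1 := (hQ t ht).continuous.measurable.comp (hx1.prodMk hx0)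
    have hd := measurable_gaussianDensity hx0 (S := fun _ => halfId D (δ t))
      (fun _ _ => measurable_const) hu0
    exact (hQm.mul ((measurable_gaussianDensity_drift hx0 (measurable_gradCur (h0 t ht) (hQ t ht)
      hx1 hx0) hu0 (κ * (δ t / 2)) (δ t)).div hd)).mul
      (measurable_smoothingRatio h0 hQ ht measurable_fst hx1 hx0 hu1)
  pot_pos t ht x2 x1 x0 u1 u0 :=
    mul_pos (mul_pos (h0 t ht _ _) (div_pos (gaussianDensity_pos _ (posDef_halfId D (hδ t ht)) _)
      (gaussianDensity_pos _ (posDef_halfId D (hδ t ht)) _))) (smoothingRatio_pos Q hδ ht _ _ _ _)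

/-- With `C` the prior covariance and `A` its gain, `(1 - A) C = (δ / 2) (1 + (δ / 2) C⁻¹)⁻¹`. The
right-hand side is visibly symmetric and positive definite. -/
theorem posDef_agradCov {C : ℕ → State D → Matrix (Fin D) (Fin D) ℝ} {t : ℕ} {x : State D}
    (hC : (C t x).PosDef) (hδ : 0 < δ t) : (agradCov C δ t x).PosDef := by
  have hS := hC.add (posDef_halfId D hδ)
  have hSu : IsUnit (C t x + halfId D (δ t)).det := hS.det_pos.ne'.isUnit
  have hCu : IsUnit (C t x).det := hC.det_pos.ne'.isUnit
  have h1 : 1 - gain (C t x) (δ t) = (C t x + halfId D (δ t))⁻¹ * halfId D (δ t) := by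
    rw [sub_eq_iff_eq_add, gain, ← Matrix.mul_add, add_comm (halfId D (δ t)),
      Matrix.nonsing_inv_mul _ hSu]
  have h2 : agradCov C δ t x = (δ t / 2) • (1 + (δ t / 2) • (C t x)⁻¹)⁻¹ := by
    have h3 : (C t x)⁻¹ * (C t x + halfId D (δ t)) = 1 + (δ t / 2) • (C t x)⁻¹ := by
      rw [Matrix.mul_add, Matrix.nonsing_inv_mul _ hCu, halfId, Matrix.mul_smul, Matrix.mul_one]
    rw [agradCov, h1, ← h3, Matrix.mul_inv_rev, Matrix.nonsing_inv_nonsing_inv _ hCu, halfId,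
      Matrix.mul_smul, Matrix.mul_one, Matrix.smul_mul]
  rw [h2]
  exact ((Matrix.PosDef.one.add (hC.inv.smul (by positivity))).inv).smul (by positivity)

theorem incr_agradPlusModel (m : ℕ → State D → State D)
    (C : ℕ → State D → Matrix (Fin D) (Fin D) ℝ) (G : ℕ → State D → State D → ℝ) {t : ℕ}
    (hC : ∀ a, (C t a).PosDef) (hδ : 0 < δ t) (x2 x1 x0 u1 u0 : State D) :
    (agradPlusModel m C G κ δ).incr t x2 x1 x0 u1 u0 = gaussianIncr m C G t x1 x0 *
      (gaussianDensity (x0 + (κ * (δ t / 2)) • gradCur G t x1 x0) (halfId D (δ t)) u0 *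
        smoothingRatio G κ δ t x2 x1 x0 u1) := by
  have h := (gaussianDensity_pos (agradMean m C δ t x1 u0) (posDef_agradCov (hC x1) hδ) x0).ne'
  simp only [AuxModel.incr, AuxModel.mutationDensity, agradPlusModel]
  field_simp

theorem measurable_gain {α : Type*} [MeasurableSpace α] {S : α → Matrix (Fin D) (Fin D) ℝ}
    (hS : ∀ i j, Measurable fun a => S a i j) (δ : ℝ) (i j : Fin D) :
    Measurable fun a => gain (S a) δ i j :=
  measurable_mul_apply (measurable_inv_apply fun i j => (hS i j).add measurable_const) hS i j

theorem measurable_agradMean {m : ℕ → State D → State D}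
    {C : ℕ → State D → Matrix (Fin D) (Fin D) ℝ} {t : ℕ} (hm : Measurable (m t))
    (hC : ∀ i j, Measurable fun a => C t a i j) :
    Measurable fun p : State D × State D => agradMean m C δ t p.1 p.2 := by
  have hm' : Measurable fun p : State D × State D => m t p.1 := hm.comp measurable_fst
  have hd : Measurable fun p : State D × State D => (p.2 - m t p.1).ofLp := by fun_prop
  exact hm'.add ((WithLp.measurable_toLp 2 _).comp (measurable_mulVec
    (measurable_gain (fun i j => (hC i j).comp measurable_fst) (δ t)) hd))

theorem measurable_agradCov {C : ℕ → State D → Matrix (Fin D) (Fin D) ℝ} {t : ℕ}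
    (hC : ∀ i j, Measurable fun a => C t a i j) (i j : Fin D) :
    Measurable fun a => agradCov C δ t a i j :=
  measurable_mul_apply (fun k l => measurable_const.sub (measurable_gain hC (δ t) k l)) hC i j

theorem measurable_gaussianIncr {m : ℕ → State D → State D}
    {C : ℕ → State D → Matrix (Fin D) (Fin D) ℝ} {G : ℕ → State D → State D → ℝ} {t : ℕ}
    (hm : Measurable (m t)) (hC : ∀ i j, Measurable fun a => C t a i j)
    (hG : Measurable fun p : State D × State D => G t p.1 p.2) :
    Measurable fun p : State D × State D => gaussianIncr m C G t p.1 p.2 :=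
  (measurable_gaussianDensity (hm.comp measurable_fst) (fun i j => (hC i j).comp measurable_fst)
    measurable_snd).mul hG

theorem gaussianIncr_pos {m : ℕ → State D → State D}
    {C : ℕ → State D → Matrix (Fin D) (Fin D) ℝ} {G : ℕ → State D → State D → ℝ} {t : ℕ}
    (hC : ∀ a, (C t a).PosDef) (hG : ∀ a b, 0 < G t a b) (a b : State D) :
    0 < gaussianIncr m C G t a b :=
  mul_pos (gaussianDensity_pos _ (hC a) _) (hG a b)

theorem regular_agradPlusModel {m : ℕ → State D → State D}
    {C : ℕ → State D → Matrix (Fin D) (Fin D) ℝ} {G : ℕ → State D → State D → ℝ}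
    (hm : ∀ t ∈ Finset.Icc 1 T, Measurable (m t))
    (hC : ∀ t ∈ Finset.Icc 1 T, ∀ i j, Measurable fun a => C t a i j)
    (hC0 : ∀ t ∈ Finset.Icc 1 T, ∀ a, (C t a).PosDef)
    (h0 : ∀ t ∈ Finset.Icc 1 T, ∀ a b, 0 < G t a b)
    (hG : ∀ t ∈ Finset.Icc 1 T, Differentiable ℝ fun p : State D × State D => G t p.1 p.2)
    (hδ : ∀ t ∈ Finset.Icc 1 T, 0 < δ t) : (agradPlusModel m C G κ δ).Regular T where
  measurable_mean t ht := measurable_agradMean (hm t ht) (hC t ht)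
  measurable_cov t ht := measurable_agradCov (hC t ht)
  posDef_cov t ht x := posDef_agradCov (hC0 t ht x) (hδ t ht)
  measurable_pot t ht := by
    have hx1 : Measurable fun p : State D × State D × State D × State D × State D => p.2.1 := by
      fun_prop
    have hx0 : Measurable fun p : State D × State D × State D × State D × State D => p.2.2.1 := by
      fun_prop
    have hu1 : Measurable fun p : State D × State D × State D × State D × State D => p.2.2.2.1 := by
      fun_prop
    have hu0 : Measurable fun p : State D × State D × State D × State D × State D => p.2.2.2.2 := by
      fun_prop
    have hQm : Measurable fun p : State D × State D × State D × State D × State D =>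
        gaussianIncr m C G t p.2.1 p.2.2.1 :=
      (measurable_gaussianIncr (hm t ht) (hC t ht) (hG t ht).continuous.measurable).comp
        (hx1.prodMk hx0)
    have hmean : Measurable fun p : State D × State D × State D × State D × State D =>
        agradMean m C δ t p.2.1 p.2.2.2.2 :=
      (measurable_agradMean (hm t ht) (hC t ht)).comp (hx1.prodMk hu0)
    have hd : Measurable fun p : State D × State D × State D × State D × State D =>
        gaussianDensity (agradMean m C δ t p.2.1 p.2.2.2.2) (agradCov C δ t p.2.1) p.2.2.1 :=
      measurable_gaussianDensity hmean (fun i j => (measurable_agradCov (hC t ht) i j).comp hx1) hx0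
    have hn := measurable_gaussianDensity_drift hx0
      (measurable_gradCur (h0 t ht) (hG t ht) hx1 hx0) hu0 (κ * (δ t / 2)) (δ t)
    have hR := measurable_smoothingRatio (κ := κ) (δ := δ) h0 hG ht measurable_fst hx1 hx0 hu1
    exact (hQm.mul (hn.div hd)).mul hR
  pot_pos t ht x2 x1 x0 u1 u0 :=
    mul_pos (mul_pos (gaussianIncr_pos (hC0 t ht) (h0 t ht) _ _)
      (div_pos (gaussianDensity_pos _ (posDef_halfId D (hδ t ht)) _)
        (gaussianDensity_pos _ (posDef_agradCov (hC0 t ht _) (hδ t ht)) _)))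
      (smoothingRatio_pos G hδ ht _ _ _ _)

theorem measurable_blockGrad {f : ℕ → State D → State D → ℝ} {F : StatePath T D → ℝ}
    (h0 : ∀ t ∈ Finset.Icc 1 T, ∀ a b, 0 < f t a b)
    (hf : ∀ t ∈ Finset.Icc 1 T, Differentiable ℝ fun p : State D × State D => f t p.1 p.2)
    {t : ℕ} (ht : t ∈ Finset.Icc 1 T)
    (hF : ∀ x, blockGrad F t x = gradCur f t (coord x (t - 1)) (coord x t) +
      if t + 1 ≤ T then gradPrev f (t + 1) (coord x t) (coord x (t + 1)) else 0) :
    Measurable (blockGrad F t) := by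
  rw [funext hF]
  refine (measurable_gradCur (h0 t ht) (hf t ht) (measurable_coord _) (measurable_coord _)).add ?_
  split_ifs with h
  · have ht1 : t + 1 ∈ Finset.Icc 1 T := Finset.mem_Icc.2 ⟨by omega, h⟩
    exact measurable_gradPrev (h0 _ ht1) (hf _ ht1) (measurable_coord _) (measurable_coord _)
  · exact measurable_const

end Models

end ParticleCSMC

open ParticleCSMC
theorem mainTheorem9 (T N D : ℕ) (hT : 1 ≤ T) (hN : 1 ≤ N) (κ : ℝ) (hκ : κ = 0 ∨ κ = 1)
    (δ : ℕ → ℝ) (hδ : ∀ t ∈ Finset.Icc 1 T, 0 < δ t) :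
    (∀ Q : ℕ → State D → State D → ℝ,
      (∀ t ∈ Finset.Icc 1 T, ∀ a b, 0 < Q t a b) →
      (∀ t ∈ Finset.Icc 1 T, Differentiable ℝ fun p : State D × State D => Q t p.1 p.2) →
      Integrable (pathProd Q T) →
      (∃ P : Kernel (StatePath T D) (StatePath T D),
        (∀ x, P x = particleAmalaPlus N Q κ δ x) ∧
        IsMarkovKernel P ∧ P.Invariant (smoothing Q T)) ∧
      ∀ x u : StatePath T D,
        smoothingDensity Q T x * auxDensity (logSmoothing Q T) κ δ x u =
          (amalaPlusModel Q κ δ).incrProd x u / ∫ y : StatePath T D, pathProd Q T y) ∧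
    (∀ (m : ℕ → State D → State D) (C : ℕ → State D → Matrix (Fin D) (Fin D) ℝ)
        (G : ℕ → State D → State D → ℝ),
      (∀ t ∈ Finset.Icc 1 T, Measurable (m t)) →
      (∀ t ∈ Finset.Icc 1 T, ∀ i j, Measurable fun a => C t a i j) →
      (∀ t ∈ Finset.Icc 1 T, ∀ a, (C t a).PosDef) →
      (∀ t ∈ Finset.Icc 1 T, ∀ a b, 0 < G t a b) →
      (∀ t ∈ Finset.Icc 1 T, Differentiable ℝ fun p : State D × State D => G t p.1 p.2) →
      Integrable (pathProd (gaussianIncr m C G) T) →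
      (∃ P : Kernel (StatePath T D) (StatePath T D),
        (∀ x, P x = particleAgradPlus N m C G κ δ x) ∧
        IsMarkovKernel P ∧ P.Invariant (smoothing (gaussianIncr m C G) T)) ∧
      ∀ x u : StatePath T D,
        smoothingDensity (gaussianIncr m C G) T x * auxDensity (logPotential G T) κ δ x u =
          (agradPlusModel m C G κ δ).incrProd x u /
            ∫ y : StatePath T D, pathProd (gaussianIncr m C G) T y) := by
  refine ⟨fun Q h0 hQ hi => ?_, fun m C G hm hC hC0 h0 hG hi => ?_⟩
  · have hgrad := fun t ht x => blockGrad_logSmoothing (t := t) h0 hQ hi ht x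
    have hid := fun x u => smoothingDensity_mul_auxDensity (κ := κ) (Q := Q) hδ x u
      (fun t ht => hgrad t ht x) fun t ht => incr_amalaPlusModel Q (hδ t ht)
    have hZ := integral_pathProd_pos h0 hi
    exact ⟨(regular_amalaPlusModel h0 hQ hδ).exists_invariant_kernel hN hT
      (fun t ht => measurable_blockGrad h0 hQ ht (hgrad t ht)) hδ
      ((measurable_pathProd fun t ht => (hQ t ht).continuous.measurable).div_const _)
      (fun x => (div_pos (pathProd_pos h0 x) hZ).le) hZ hid, hid⟩
  · have hgrad := fun t ht x => blockGrad_logPotential (t := t) h0 hG ht x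
    have hid := fun x u => smoothingDensity_mul_auxDensity (κ := κ) (Q := gaussianIncr m C G) hδ x u
      (fun t ht => hgrad t ht x) fun t ht => incr_agradPlusModel m C G (hC0 t ht) (hδ t ht)
    have hQ0 : ∀ t ∈ Finset.Icc 1 T, ∀ a b, 0 < gaussianIncr m C G t a b := fun t ht =>
      gaussianIncr_pos (hC0 t ht) (h0 t ht)
    have hZ := integral_pathProd_pos hQ0 hi
    exact ⟨(regular_agradPlusModel hm hC hC0 h0 hG hδ).exists_invariant_kernel hN hT
      (fun t ht => measurable_blockGrad h0 hG ht (hgrad t ht)) hδ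
      ((measurable_pathProd fun t ht => measurable_gaussianIncr (hm t ht) (hC t ht)
        (hG t ht).continuous.measurable).div_const _)
      (fun x => (div_pos (pathProd_pos hQ0 x) hZ).le) hZ hid, hid⟩
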